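/- \textbf{Setting.} A configuration is a subset $\varphi\subset\mathbb Z^3$; it is admissible for $D^2=6$ if distinct $x,y\in\varphi$ have Euclidean distance $\rho(x,y)\ge\sqrt6$. Let $f(0)=1$, $f(1)=\frac23$, $f(2)=\frac13$, $f(3)=\frac18$, $f(4)=\frac16$, $f(5)=\frac1{24}$, and put $$U(\varphi,x)=\frac1{12}\sum_{y\in\varphi,\ \rho(x,y)<\sqrt6}f(\rho(x,y)^2),\qquad x\in\mathbb Z^3 .$$ A perfect configuration (PC) for $D^2=6$ is an admissible $\varphi$ such that, for every $x\in\mathbb Z^3$, $U(\varphi,x)$ equals the maximum of $U(\psi,y)$ over all admissible $\psi$ and all $y\in\mathbb Z^3$. A configuration is periodic if it is invariant under three linearly independent integer shifts. Its particle density is $\lim_{n\to\infty}|\varphi\cap[-n,n]^3|/(2n+1)^3$. \textbf{Triangular family.} Let $(1,s_2,s_3)$ be one of the main diagonals $(1,1,1),(1,-1,1),(1,-1,-1),(1,1,-1)$. Put $w_1=(1,-2s_2,s_3)$, $w_2=(-1,-s_2,2s_3)$, $w_3=(-2,s_2,s_3)$, $w_4=-w_1$, $w_6=-w_3$, and let $\tau=\{mw_1+nw_2: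 m,n\in\mathbb Z\}$, a triangular $\sqrt6$-lattice. An allowed stacking is a sequence of meshes $(\gamma_k)_{k\in\mathbb Z}$ with $\gamma_0=\tau$ and, for every $k\in\mathbb Z$, $\gamma_{k+1}=\gamma_k+\frac13w_j$ for some $j\in\{2,4,6\}$. The corresponding layered configuration is $\bigcup_{k\in\mathbb Z}\bigl(\frac{4k}3(1,s_2,s_3)+\gamma_k\bigr)\subset\mathbb Z^3$. \textbf{Rhombic family.} Let $s=(s_1,s_2,s_3)$ be one of the non-main diagonals $(1,1,0),(-1,1,0),(1,0,1),(-1,0,1),(0,1,1),(0,-1,1)$. Put $a=(1-|s_1|,1-|s_2|,1-|s_3|)$ and $$b=\tfrac12\bigl(s_2-s_2|s_3|-s_3+s_3|s_2|,\ s_3-s_3|s_1|-s_1+s_1|s_3|,\ s_1-s_1|s_2|-s_2+s_2|s_1|\bigr),$$ so that $s,a,b$ are orthogonal, $|a|=1$ and $|b|=\sqrt2/2$. Let $\alpha=\{m(2a+2b)+n(2a-2b): m,n\in\mathbb Z\}$, a rhombic lattice with rhombus diagonals $\sqrt8,\sqrt{16}$. An allowed stacking is a sequence of meshes $(\gamma_k)_{k\in\mathbb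 Z}$ with $\gamma_0=\alpha$ and, for every $k\in\mathbb Z$, $\gamma_{k+1}=\gamma_k+a+b$ or $\gamma_{k+1}=\gamma_k+a-b$. The corresponding layered configuration is $\bigcup_{k\in\mathbb Z}\bigl(\frac{3k}2s+\gamma_k\bigr)\subset\mathbb Z^3$. Let $\mathscr S^{(6)}$ be the set of all layered configurations of both families and all their $\mathbb Z^3$-shifts, and let $\mathscr S^{(6)}_{\rm per}$ be the subset given by the periodic stackings (those with $\gamma_{k+p}=\gamma_k$ for all $k$, for some $p\ge1$) and their $\mathbb Z^3$-shifts. \textbf{Theorem.} The set of all PCs for $D^2=6$ is $\mathscr S^{(6)}$, and $\mathscr S^{(6)}$ has the cardinality of the continuum. The set of all periodic PCs for $D^2=6$ is $\mathscr S^{(6)}_{\rm per}$, and $\mathscr S^{(6)}_{\rm per}$ is countably infinite. Every configuration in $\mathscr S^{(6)}$ has particle density $1/12$. -/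

import Mathlib

/-! ### Configurations on `ℤ³` and the local repelling forces for `D² = 6` -/

/-- A site of the cubic lattice `ℤ³`. A configuration is identified with its set of occupied
sites. -/
abbrev Site := Fin 3 → ℤ

/-- The square `ρ(x, y)²` of the Euclidean distance between two sites. -/
def sqDist (x y : Site) : ℤ := ∑ l, (x l - y l) ^ 2

/-- `D`-admissibility, with `d = D²`: distinct occupied sites are at Euclidean distance at least
`D` from each other. -/
def Admissible (d : ℤ) (φ : Set Site) : Prop := φ.Pairwise fun x y => d ≤ sqDist x y

/-- The open lattice ball `B(x) = {y ∈ ℤ³ : ρ(x, y) < √6}`; see `mem_ball`. -/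
noncomputable def ball (x : Site) : Finset Site :=
  (Finset.Icc (fun l => x l - 2) (fun l => x l + 2)).filter fun y => sqDist x y < 6

theorem mem_ball (x y : Site) : y ∈ ball x ↔ sqDist x y < 6 := by
  unfold ball
  rw [Finset.mem_filter, Finset.mem_Icc, and_iff_right_iff_imp]
  intro h
  have key : ∀ l, (x l - y l) ^ 2 < 6 := fun l =>
    lt_of_le_of_lt
      (Finset.single_le_sum (f := fun l => (x l - y l) ^ 2) (fun i _ => sq_nonneg _)
        (Finset.mem_univ l)) h
  constructor <;> intro l <;> have := key l <;> simp only <;> nlinarith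

/-- The local repelling forces for `D² = 6`, as a function of the squared distance. -/
def force (t : ℤ) : ℚ :=
  if t = 0 then 1
  else if t = 1 then 2 / 3
  else if t = 2 then 1 / 3
  else if t = 3 then 1 / 8
  else if t = 4 then 1 / 6
  else if t = 5 then 1 / 24
  else 0

open Classical in
/-- The potential `U(φ↾B(x)) = (1/12) ∑_{y ∈ B(x)} φ(y) f(ρ(x, y)²)`, i.e. the total force acting on
the site `x` divided by the normalizing constant `∑_y f(ρ(x, y)²) = 12`. For fugacity `u > 1` the
energy `- ln u` per particle is distributed over the sites as `- ln u · U`, so least local energy is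
greatest `U`. -/
noncomputable def potential (φ : Set Site) (x : Site) : ℚ :=
  1 / 12 * ∑ y ∈ ball x, if y ∈ φ then force (sqDist x y) else 0

/-- Perfect configurations for `D² = 6`: the admissible configurations for which the local potential
at every site has its optimal value, the optimum being taken over all sites and all admissible
configurations. -/
def IsPerfect (φ : Set Site) : Prop :=
  Admissible 6 φ ∧
    ∀ x, IsGreatest {t : ℚ | ∃ (y : Site) (ψ : Set Site), Admissible 6 ψ ∧ potential ψ y = t}
      (potential φ x)

/-- Periodicity: invariance under the shifts by three linearly independent integer vectors. -/
def IsPeriodic (φ : Set Site) : Prop :=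
  ∃ e : Fin 3 → Site, LinearIndependent ℤ e ∧ ∀ i x, x + e i ∈ φ ↔ x ∈ φ

/-- Particle density: the limit of the fraction of occupied sites in the cubes `[-n, n]³`. -/
def HasDensity (φ : Set Site) (δ : ℝ) : Prop :=
  Filter.Tendsto
    (fun n : ℕ => ((φ ∩ Set.Icc (fun _ => -(n : ℤ)) (fun _ => (n : ℤ))).ncard : ℝ)
      / (2 * (n : ℝ) + 1) ^ 3)
    Filter.atTop (nhds δ)

/-! ### Meshes and layered configurations

All the meshes below consist of points with rational coordinates. -/

/-- Points with rational coordinates. -/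
abbrev Pt := Fin 3 → ℚ

/-- The shift `χ + v`. -/
def shift {G : Type*} [Add G] (χ : Set G) (v : G) : Set G := (fun x => x + v) '' χ

/-- The sites of `ℤ³` that lie in a set of points. -/
def sitesOf (χ : Set Pt) : Set Site := {x | (fun l => (x l : ℚ)) ∈ χ}

/-- The two-dimensional lattice generated by `g₁` and `g₂`. -/
def planeLattice (g₁ g₂ : Pt) : Set Pt := {p | ∃ m n : ℤ, p = (m : ℚ) • g₁ + (n : ℚ) • g₂}

/-- The four main diagonals `(1, s₂, s₃)`. -/
def mainDiag : Fin 4 → Pt := ![![1, 1, 1], ![1, -1, 1], ![1, -1, -1], ![1, 1, -1]]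

/-- The vectors `w₀ = 0` and `w₁, …, w₆` of length `√6` orthogonal to a main diagonal. -/
def triVec (i : Fin 4) : Fin 7 → Pt :=
  let s₂ := mainDiag i 1
  let s₃ := mainDiag i 2
  ![![0, 0, 0],
    ![1, -2 * s₂, s₃], ![-1, -s₂, 2 * s₃], ![-2, s₂, s₃],
    -![1, -2 * s₂, s₃], -![-1, -s₂, 2 * s₃], -![-2, s₂, s₃]]

/-- The triangular `√6`-lattice orthogonal to a main diagonal. -/
def triMesh (i : Fin 4) : Set Pt := planeLattice (triVec i 1) (triVec i 2)

/-- Allowed stackings of triangular meshes; `γ k` is the orthogonal projection of the `k`-th layer to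
the plane through the origin. Successive projected meshes differ by a shift by `w_j / 3` with
`j ∈ {2, 4, 6}`. -/
def IsTriStacking (i : Fin 4) (γ : ℤ → Set Pt) : Prop :=
  γ 0 = triMesh i ∧
    ∀ k, ∃ j : Fin 7, (j = 2 ∨ j = 4 ∨ j = 6) ∧ γ (k + 1) = shift (γ k) ((1 / 3 : ℚ) • triVec i j)

/-- The layered configuration whose `k`-th layer is `(4k/3) (1, s₂, s₃) + γ k`, a mesh in the plane
`x₁ + s₂ x₂ + s₃ x₃ = 4k`. -/
def triLayered (i : Fin 4) (γ : ℤ → Set Pt) : Set Site :=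
  sitesOf (⋃ k : ℤ, shift (γ k) ((4 * (k : ℚ) / 3) • mainDiag i))

/-- The six non-main diagonals `(s₁, s₂, s₃)`. -/
def nonMainDiag : Fin 6 → Pt :=
  ![![1, 1, 0], ![-1, 1, 0], ![1, 0, 1], ![-1, 0, 1], ![0, 1, 1], ![0, -1, 1]]

/-- The unit vector `a` along the coordinate axis orthogonal to a non-main diagonal. -/
def vecA (i : Fin 6) : Pt := fun l => 1 - |nonMainDiag i l|

/-- The vector `b` of length `√2 / 2` orthogonal to a non-main diagonal and to `a`. -/
def vecB (i : Fin 6) : Pt :=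
  let s₁ := nonMainDiag i 0
  let s₂ := nonMainDiag i 1
  let s₃ := nonMainDiag i 2
  (1 / 2 : ℚ) •
    ![s₂ - s₂ * |s₃| - s₃ + s₃ * |s₂|,
      s₃ - s₃ * |s₁| - s₁ + s₁ * |s₃|,
      s₁ - s₁ * |s₂| - s₂ + s₂ * |s₁|]

/-- The rhombic lattice, generated by two vectors of length `√6`, whose rhombus has diagonals
`√8` and `√16`. -/
def rhoMesh (i : Fin 6) : Set Pt :=
  planeLattice ((2 : ℚ) • vecA i + (2 : ℚ) • vecB i) ((2 : ℚ) • vecA i - (2 : ℚ) • vecB i)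

/-- Allowed stackings of rhombic meshes; `γ k` is the orthogonal projection of the `k`-th layer to the
plane through the origin. Successive projected meshes differ by a shift by `a + b` or `a - b`. -/
def IsRhoStacking (i : Fin 6) (γ : ℤ → Set Pt) : Prop :=
  γ 0 = rhoMesh i ∧
    ∀ k, γ (k + 1) = shift (γ k) (vecA i + vecB i) ∨ γ (k + 1) = shift (γ k) (vecA i - vecB i)

/-- The layered configuration whose `k`-th layer is `(3k/2) (s₁, s₂, s₃) + γ k`, a mesh in the plane
`s₁ x₁ + s₂ x₂ + s₃ x₃ = 3k`. -/
def rhoLayered (i : Fin 6) (γ : ℤ → Set Pt) : Set Site :=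
  sitesOf (⋃ k : ℤ, shift (γ k) ((3 * (k : ℚ) / 2) • nonMainDiag i))

/-- A sequence of meshes is periodic if it is obtained by repeating a finite string. -/
def IsPeriodicStacking (γ : ℤ → Set Pt) : Prop := ∃ p : ℕ, 0 < p ∧ ∀ k, γ (k + p) = γ k

/-- The set `𝒮⁽⁶⁾`: all layered configurations of the two families and their `ℤ³`-shifts. -/
def layeredSet : Set (Set Site) :=
  {φ | ∃ v : Site,
    (∃ i γ, IsTriStacking i γ ∧ φ = shift (triLayered i γ) v) ∨
    (∃ i γ, IsRhoStacking i γ ∧ φ = shift (rhoLayered i γ) v)}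

/-- The subset of `𝒮⁽⁶⁾` given by the periodic stackings. -/
def periodicLayeredSet : Set (Set Site) :=
  {φ | ∃ v : Site,
    (∃ i γ, IsTriStacking i γ ∧ IsPeriodicStacking γ ∧ φ = shift (triLayered i γ) v) ∨
    (∃ i γ, IsRhoStacking i γ ∧ IsPeriodicStacking γ ∧ φ = shift (rhoLayered i γ) v)}

/-!
A site feels only the particles of an open ball of radius `√6`, and that ball is a union of a few
cliques of mutually conflicting sites, so branch and bound over the cliques finds the maximum `1/12`
of the potential and all the sets of particles in the ball that attain it. A configuration is
therefore perfect exactly when each site sees one of these optimal sets.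

Branching over the optimal sets around the sites near a particle shows that its neighbors at
distance `√6` include those it has in some stack of layers. If the steps from the layer of the
particle up to the next one and from the previous one up to it differ, the same neighborhood recurs
around the lattice neighbors of the particle. If they are equal, the layers can be taken to be
triangular, because a rhombic stack with equal steps is also a triangular one; the neighborhood then
either recurs or turns into one between different steps. In both cases a whole layer is occupied. An
occupied layer forces occupied layers on both sides of it, so a perfect configuration contains a
stack of layers.

Conversely, around each site a stack of layers is an optimal set; modulo the lattice of a layer and
a step there are finitely many sites to examine. Since every site is within distance `√6` of a
particle of a perfect configuration, no two perfect configurations are strictly nested, and a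
perfect configuration equals the stack that it contains.

The total force exerted by one particle is `12`, so summing the potential over a cube counts the
particles in it up to a boundary layer of width `2`; this gives the density.
-/

open scoped Matrix

/-! ### Weighted independent sets -/

section WeightedSearch

variable {α : Type*} (w : α → ℕ) (r : α → α → Prop)

/-- The total weight of the elements of `φ` in a list. -/
noncomputable def weightIn (φ : Set α) (l : List α) : ℕ := (l.map (φ.indicator w)).sum

/-- A clique of the conflict graph of `r`: a list of which an `r`-pairwise set contains at most one
element. -/
def IsConflictClique (g : List α) : Prop := g.Pairwise fun p q => p ≠ q ∧ ¬r p q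

/-- The largest weight in a list, and `0` for the empty list. -/
def maxWeight (g : List α) : ℕ := (g.map w).foldr max 0

variable {w r} {φ : Set α}

theorem weightIn_cons_of_mem {p : α} (l : List α) (hp : p ∈ φ) :
    weightIn w φ (p :: l) = w p + weightIn w φ l := by simp [weightIn, hp]

theorem weightIn_cons_of_notMem {p : α} (l : List α) (hp : p ∉ φ) :
    weightIn w φ (p :: l) = weightIn w φ l := by simp [weightIn, hp]

theorem weightIn_append (l l' : List α) :
    weightIn w φ (l ++ l') = weightIn w φ l + weightIn w φ l' := by simp [weightIn]

theorem weightIn_eq_zero {l : List α} (h : ∀ p ∈ l, p ∉ φ) : weightIn w φ l = 0 :=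
  List.sum_eq_zero fun n hn => by
    obtain ⟨p, hp, rfl⟩ := List.mem_map.1 hn
    exact Set.indicator_of_notMem (h p hp) w

theorem weightIn_eq_sum_toFinset [DecidableEq α] {l : List α} (hl : l.Nodup) :
    weightIn w φ l = ∑ p ∈ l.toFinset, φ.indicator w p :=
  (List.sum_toFinset _ hl).symm

theorem IsConflictClique.weightIn_eq {g : List α} (hφ : φ.Pairwise r) (hg : IsConflictClique r g) :
    weightIn w φ g = 0 ∨ ∃ p ∈ g, p ∈ φ ∧ weightIn w φ g = w p := by
  induction g with
  | nil => exact .inl rfl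
  | cons a g ih =>
    obtain ⟨ha, hg⟩ := List.pairwise_cons.1 hg
    by_cases haφ : a ∈ φ
    · have hgφ : ∀ p ∈ g, p ∉ φ := fun p hp hpφ => (ha p hp).2 (hφ haφ hpφ (ha p hp).1)
      refine .inr ⟨a, List.mem_cons_self, haφ, ?_⟩
      rw [weightIn_cons_of_mem g haφ, weightIn_eq_zero hgφ, add_zero]
    · rw [weightIn_cons_of_notMem g haφ]
      exact (ih hg).imp_right fun ⟨p, hp, h⟩ => ⟨p, List.mem_cons_of_mem a hp, h⟩

theorem le_maxWeight {g : List α} {p : α} (hp : p ∈ g) : w p ≤ maxWeight w g :=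
  List.le_max_of_le (List.mem_map_of_mem hp) le_rfl

variable [DecidableRel r] [DecidableEq α]

variable (w r) in
/-- The elements of `g` that are compatible with all the elements of `P`. -/
def compatible (P g : List α) : List α := g.filter fun p => ∀ q ∈ P, r p q ∨ p = q

variable (w r) in
/-- Branch and bound: the ways to choose at most one element from each of the cliques `gs`,
compatible with each other and with `P`, of total weight at least `n`. -/
def completions : List (List α) → ℕ → List α → List (List α)
  | [], n, _ => bif n.beq 0 then [[]] else []
  | g :: gs, n, P =>
    bif (((g :: gs).map fun g => maxWeight w (compatible r P g)).sum).blt n then []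
    else ((compatible r P g).flatMap fun p =>
      (completions gs (n - w p) (p :: P)).map (p :: ·)) ++ completions gs n P

variable (w r) in
/-- The nonempty choices of total weight at least `n`, grouped by the element chosen first. -/
def branches : List (List α) → ℕ → List (α × List (List α))
  | [], _ => []
  | g :: gs, n => (g.map fun p => (p, completions w r gs (n - w p) [p])) ++ branches gs n

theorem mem_compatible {P g : List α} {p : α} (hφ : φ.Pairwise r) (hP : ∀ q ∈ P, q ∈ φ)
    (hp : p ∈ g) (hpφ : p ∈ φ) : p ∈ compatible r P g :=
  List.mem_filter.2 ⟨hp, decide_eq_true fun q hq => or_iff_not_imp_right.2 (hφ hpφ (hP q hq))⟩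

theorem weightIn_flatten_le {P : List α} {gs : List (List α)} (hφ : φ.Pairwise r)
    (hP : ∀ q ∈ P, q ∈ φ) (hgs : ∀ g ∈ gs, IsConflictClique r g) :
    weightIn w φ gs.flatten ≤ (gs.map fun g => maxWeight w (compatible r P g)).sum := by
  induction gs with
  | nil => exact le_rfl
  | cons g gs ih =>
    obtain ⟨hg, hgs⟩ := List.forall_mem_cons.1 hgs
    rw [List.flatten_cons, weightIn_append, List.map_cons, List.sum_cons]
    refine add_le_add ?_ (ih hgs)
    rcases hg.weightIn_eq hφ with h | ⟨p, hp, hpφ, h⟩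
    · exact h.trans_le (Nat.zero_le _)
    · exact h.trans_le (le_maxWeight (mem_compatible hφ hP hp hpφ))

theorem exists_mem_completions {gs : List (List α)} {n : ℕ} {P : List α} (hφ : φ.Pairwise r)
    (hgs : ∀ g ∈ gs, IsConflictClique r g) (hP : ∀ q ∈ P, q ∈ φ)
    (hn : n ≤ weightIn w φ gs.flatten) :
    ∃ Q ∈ completions w r gs n P, (∀ q ∈ Q, q ∈ φ) ∧
      (Q.map w).sum = weightIn w φ gs.flatten := by
  induction gs generalizing n P with
  | nil => exact ⟨[], by simp [completions, Nat.le_zero.1 hn], by simp, rfl⟩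
  | cons g gs ih =>
    have hbound := hn.trans (weightIn_flatten_le hφ hP hgs)
    obtain ⟨hg, hgs⟩ := List.forall_mem_cons.1 hgs
    rw [List.flatten_cons, weightIn_append] at hn ⊢
    have hmem (Q : List α) : Q ∈ completions w r (g :: gs) n P ↔
        (∃ p ∈ compatible r P g, ∃ R ∈ completions w r gs (n - w p) (p :: P), p :: R = Q) ∨
          Q ∈ completions w r gs n P := by
      rw [completions, cond_eq_ite, if_neg (by rwa [Nat.blt_eq, not_lt])]
      simp only [List.mem_append, List.mem_flatMap, List.mem_map]
    simp only [hmem]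
    rcases hg.weightIn_eq hφ with h | ⟨p, hp, hpφ, h⟩ <;> rw [h] at hn ⊢
    · rw [zero_add] at hn ⊢
      obtain ⟨Q, hQ, hQφ⟩ := ih hgs hP hn
      exact ⟨Q, .inr hQ, hQφ⟩
    · obtain ⟨Q, hQ, hQφ, hQw⟩ := ih hgs (List.forall_mem_cons.2 ⟨hpφ, hP⟩)
        (Nat.sub_le_iff_le_add'.2 hn)
      refine ⟨p :: Q, .inl ⟨p, mem_compatible hφ hP hp hpφ, Q, hQ, rfl⟩,
        List.forall_mem_cons.2 ⟨hpφ, hQφ⟩, ?_⟩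
      rw [List.map_cons, List.sum_cons, hQw]

theorem exists_mem_branches {gs : List (List α)} {n : ℕ} (hφ : φ.Pairwise r)
    (hgs : ∀ g ∈ gs, IsConflictClique r g) (hpos : 0 < weightIn w φ gs.flatten)
    (hn : n ≤ weightIn w φ gs.flatten) :
    ∃ p Ps, (p, Ps) ∈ branches w r gs n ∧ ∃ P ∈ Ps, (∀ q ∈ p :: P, q ∈ φ) ∧
      ((p :: P).map w).sum = weightIn w φ gs.flatten := by
  induction gs with
  | nil => exact absurd hpos (lt_irrefl 0)
  | cons g gs ih =>
    obtain ⟨hg, hgs⟩ := List.forall_mem_cons.1 hgs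
    simp only [branches, List.mem_append, List.mem_map]
    rw [List.flatten_cons, weightIn_append] at hn hpos ⊢
    rcases hg.weightIn_eq hφ with h | ⟨p, hp, hpφ, h⟩ <;> rw [h] at hn hpos ⊢
    · rw [zero_add] at hn hpos ⊢
      obtain ⟨p, Ps, hmem, hPs⟩ := ih hgs hpos hn
      exact ⟨p, Ps, .inr hmem, hPs⟩
    · obtain ⟨P, hP, hPφ, hPw⟩ := exists_mem_completions (P := [p]) hφ hgs (by simpa using hpφ)
        (Nat.sub_le_iff_le_add'.2 hn)
      refine ⟨p, _, .inl ⟨p, hp, rfl⟩, P, hP, List.forall_mem_cons.2 ⟨hpφ, hPφ⟩, ?_⟩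
      rw [List.map_cons, List.sum_cons, hPw]

end WeightedSearch

/-! ### The maximum of the local potential -/

/-- A partition of the ball around the origin into cliques of sites at squared distances less
than `6` from each other, ordered by the distance from the origin. -/
def ballCliques : List (List Site) :=
  [[![0, 0, 0], ![1, 0, 0], ![-1, 0, 0], ![0, 1, 0], ![0, -1, 0], ![0, 0, 1], ![0, 0, -1]],
   [![1, 1, 0], ![0, 1, 1], ![1, 0, 1]], [![-1, -1, 0], ![0, -1, 1], ![-1, 0, 1]],
   [![-1, 1, 0], ![0, 1, -1], ![-1, 0, -1]], [![1, -1, 0], ![0, -1, -1], ![1, 0, -1]],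
   [![1, 1, 1], ![1, 1, -1]], [![1, -1, 1], ![1, -1, -1]],
   [![-1, 1, 1], ![-1, 1, -1]], [![-1, -1, 1], ![-1, -1, -1]],
   [![2, 0, 0], ![2, 1, 0], ![2, -1, 0], ![2, 0, 1], ![2, 0, -1]],
   [![-2, 0, 0], ![-2, 1, 0], ![-2, -1, 0], ![-2, 0, 1], ![-2, 0, -1]],
   [![0, 2, 0], ![1, 2, 0], ![-1, 2, 0], ![0, 2, 1], ![0, 2, -1]],
   [![0, -2, 0], ![1, -2, 0], ![-1, -2, 0], ![0, -2, 1], ![0, -2, -1]],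
   [![0, 0, 2], ![1, 0, 2], ![-1, 0, 2], ![0, 1, 2], ![0, -1, 2]],
   [![0, 0, -2], ![1, 0, -2], ![-1, 0, -2], ![0, 1, -2], ![0, -1, -2]]]

/-- The sites of the ball around the origin, the origin first. -/
def ballSites : List Site := ballCliques.flatten

/-- The force, scaled by `24` to make it integral. -/
def forceWeight (t : ℤ) : ℕ :=
  if t = 0 then 24 else if t = 1 then 16 else if t = 2 then 8 else if t = 3 then 3
  else if t = 4 then 4 else if t = 5 then 1 else 0

/-- The contribution of an occupied site to the potential at the origin, scaled by `288`. -/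
def siteWeight (y : Site) : ℕ := forceWeight (sqDist 0 y)

/-- The optimal sets, grouped by their first site. -/
def optimalGroups : List (Site × List (List Site)) :=
  (branches siteWeight (fun x y => 6 ≤ sqDist x y) ballCliques 24).filter fun q => !q.2.isEmpty

/-- The sets of occupied sites in the ball around the origin for which the potential at the origin
is greatest. -/
def optimalSets : List (List Site) := optimalGroups.flatMap fun q => q.2.map (q.1 :: ·)

/-- The cube `[-n, n]³`. -/
def InCube (n : ℤ) (y : Site) : Prop := ∀ l, |y l| ≤ n

instance (n : ℤ) (y : Site) : Decidable (InCube n y) := inferInstanceAs (Decidable (∀ _, _))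

theorem mem_optimalSets {P : List Site} :
    P ∈ optimalSets ↔ ∃ q ∈ optimalGroups, ∃ R ∈ q.2, q.1 :: R = P := by
  simp only [optimalSets, List.mem_flatMap, List.mem_map]

set_option maxRecDepth 10000 in
theorem optimalSets_spec :
    ∀ P ∈ optimalSets, (∀ p ∈ P, InCube 2 p) ∧ (P.map siteWeight).sum = 24 := by
  decide +kernel

theorem isConflictClique_ballCliques :
    ∀ g ∈ ballCliques, IsConflictClique (fun x y => 6 ≤ sqDist x y) g := by
  unfold IsConflictClique
  decide +kernel

theorem sqDist_comm (x y : Site) : sqDist x y = sqDist y x :=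
  Finset.sum_congr rfl fun _ _ => sub_sq_comm _ _

theorem sqDist_add_left (x y z : Site) : sqDist (x + y) (x + z) = sqDist y z := by
  simp [sqDist]

theorem sqDist_sub (x y z : Site) : sqDist x (y - z) = sqDist (x + z) y := by
  simp [sqDist, sub_sub_eq_add_sub]

theorem sqDist_self_add (x y : Site) : sqDist x (x + y) = sqDist 0 y := by
  simpa using sqDist_add_left x 0 y

theorem Admissible.eq_of_sqDist_lt {d : ℤ} {φ : Set Site} (hφ : Admissible d φ) {x y : Site}
    (hx : x ∈ φ) (hy : y ∈ φ) (h : sqDist x y < d) : x = y :=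
  hφ.eq hx hy (not_le.2 h)

theorem Admissible.preimage_add {d : ℤ} {φ : Set Site} (hφ : Admissible d φ) (x : Site) :
    Admissible d ((x + ·) ⁻¹' φ) := fun y hy z hz hne => by
  simpa only [sqDist_add_left] using hφ hy hz ((add_right_injective x).ne hne)

theorem exists_optimalSet_subset {φ : Set Site} (hφ : Admissible 6 φ)
    (h : 24 ≤ weightIn siteWeight φ ballSites) :
    weightIn siteWeight φ ballSites = 24 ∧ ∃ P ∈ optimalSets, ∀ p ∈ P, p ∈ φ := by
  obtain ⟨p, Ps, hmem, P, hP, hPφ, hPw⟩ :=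
    exists_mem_branches hφ isConflictClique_ballCliques (Nat.zero_lt_of_lt h) h
  have hne : !Ps.isEmpty := by simpa using List.ne_nil_of_mem hP
  have hopt : p :: P ∈ optimalSets :=
    mem_optimalSets.2 ⟨(p, Ps), List.mem_filter.2 ⟨hmem, hne⟩, P, hP, rfl⟩
  exact ⟨hPw.symm.trans (optimalSets_spec _ hopt).2, _, hopt, hPφ⟩

theorem Admissible.weightIn_ballSites_le {φ : Set Site} (hφ : Admissible 6 φ) :
    weightIn siteWeight φ ballSites ≤ 24 := by
  by_contra! h
  exact h.ne' (exists_optimalSet_subset hφ h.le).1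

theorem nodup_ballSites : ballSites.Nodup := by decide +kernel

theorem mem_ballSites {q : Site} : q ∈ ballSites ↔ sqDist 0 q < 6 := by
  constructor
  · exact (by decide +kernel : ∀ q ∈ ballSites, sqDist 0 q < 6) q
  · intro h
    have hcube : ∀ q : Fin 3 → Finset.Icc (-2 : ℤ) 2, sqDist 0 (fun l => q l) < 6 →
        (fun l => (q l : ℤ)) ∈ ballSites := by decide +kernel
    have hq := Finset.mem_Icc.1 (Finset.mem_filter.1 ((mem_ball 0 q).2 h)).1
    exact hcube (fun l => ⟨q l, Finset.mem_Icc.2 (by simpa using ⟨hq.1 l, hq.2 l⟩)⟩) h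

theorem force_eq_forceWeight (t : ℤ) : force t = (forceWeight t : ℚ) / 24 := by
  unfold force forceWeight
  split_ifs <;> norm_num

theorem ball_eq_image (x : Site) : ball x = ballSites.toFinset.image (x + ·) := by
  ext y
  simp only [mem_ball, Finset.mem_image, List.mem_toFinset, mem_ballSites]
  constructor
  · exact fun h => ⟨y - x, by rwa [sqDist_sub, zero_add], add_sub_cancel x y⟩
  · rintro ⟨q, hq, rfl⟩
    rwa [sqDist_self_add]

theorem potential_eq_weightIn (φ : Set Site) (x : Site) :
    potential φ x = (weightIn siteWeight ((x + ·) ⁻¹' φ) ballSites : ℚ) / 288 := by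
  classical
  rw [potential, ball_eq_image, Finset.sum_image (by simp),
    weightIn_eq_sum_toFinset nodup_ballSites, Nat.cast_sum, Finset.mul_sum, Finset.sum_div]
  refine Finset.sum_congr rfl fun p _ => ?_
  rw [Set.indicator_apply, Set.mem_preimage, sqDist_self_add, force_eq_forceWeight, siteWeight]
  split_ifs
  · ring
  · simp

theorem Admissible.potential_le {φ : Set Site} (hφ : Admissible 6 φ) (x : Site) :
    potential φ x ≤ 1 / 12 := by
  have h : (weightIn siteWeight ((x + ·) ⁻¹' φ) ballSites : ℚ) ≤ 24 := by
    exact_mod_cast (hφ.preimage_add x).weightIn_ballSites_le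
  rw [potential_eq_weightIn]
  linarith

theorem potential_singleton : potential {0} 0 = 1 / 12 := by
  classical
  have h0 : (0 : Site) ∈ ball 0 := (mem_ball _ _).2 (by simp [sqDist])
  simp [potential, h0, sqDist, force]

theorem isPerfect_iff_potential {φ : Set Site} :
    IsPerfect φ ↔ Admissible 6 φ ∧ ∀ x, potential φ x = 1 / 12 := by
  have hmax : IsGreatest {t : ℚ | ∃ (y : Site) (ψ : Set Site), Admissible 6 ψ ∧ potential ψ y = t}
      (1 / 12) := by
    refine ⟨⟨0, {0}, Set.pairwise_singleton _ _, potential_singleton⟩, ?_⟩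
    rintro t ⟨y, ψ, hψ, rfl⟩
    exact hψ.potential_le y
  exact and_congr_right fun _ => forall_congr' fun x =>
    ⟨fun h => h.unique hmax, fun h => h ▸ hmax⟩

theorem IsPerfect.exists_optimalSet {φ : Set Site} (hφ : IsPerfect φ) (x : Site) :
    ∃ P ∈ optimalSets, ∀ p ∈ P, x + p ∈ φ := by
  refine (exists_optimalSet_subset (hφ.1.preimage_add x) ?_).2
  have h := (isPerfect_iff_potential.1 hφ).2 x
  rw [potential_eq_weightIn, div_eq_div_iff (by norm_num) (by norm_num)] at h
  have : (24 : ℚ) ≤ weightIn siteWeight ((x + ·) ⁻¹' φ) ballSites := by linarith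
  exact_mod_cast this

theorem Admissible.isPerfect_of_le_weightIn {φ : Set Site} (hφ : Admissible 6 φ)
    (h : ∀ x, 24 ≤ weightIn siteWeight ((x + ·) ⁻¹' φ) ballSites) : IsPerfect φ := by
  refine isPerfect_iff_potential.2 ⟨hφ, fun x => ?_⟩
  rw [potential_eq_weightIn, (exists_optimalSet_subset (hφ.preimage_add x) (h x)).1]
  norm_num

theorem IsPerfect.exists_mem_ball {φ : Set Site} (hφ : IsPerfect φ) (x : Site) :
    ∃ y ∈ ball x, y ∈ φ := by
  classical
  have h : potential φ x ≠ 0 := by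
    rw [(isPerfect_iff_potential.1 hφ).2 x]
    norm_num
  obtain ⟨y, hy, hne⟩ := Finset.exists_ne_zero_of_sum_ne_zero (right_ne_zero_of_mul h)
  exact ⟨y, hy, (ite_ne_right_iff.1 hne).1⟩

theorem IsPerfect.eq_of_subset {φ ψ : Set Site} (hφ : IsPerfect φ) (hψ : Admissible 6 ψ)
    (h : φ ⊆ ψ) : φ = ψ := by
  refine h.antisymm fun y hy => ?_
  obtain ⟨z, hz, hzφ⟩ := hφ.exists_mem_ball y
  rwa [hψ.eq_of_sqDist_lt hy (h hzφ) ((mem_ball _ _).1 hz)]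

/-! ### Forcing -/

theorem InCube.add {m n : ℤ} {x y : Site} (hx : InCube m x) (hy : InCube n y) :
    InCube (m + n) (x + y) := fun l =>
  (abs_add_le _ _).trans (add_le_add (hx l) (hy l))

theorem InCube.mono {m n : ℤ} {x : Site} (hx : InCube m x) (h : m ≤ n) : InCube n x := fun l =>
  (hx l).trans h

/-- The position of a site of the cube `[-k, k]³` in a bit mask: the coordinates are digits in base
`16`, translated by `k` to make them nonnegative. -/
def bitIndex (k : ℤ) (y : Site) : ℕ := (y 0 + 16 * y 1 + 256 * y 2 + 273 * k).toNat

/-- The bit mask of a list of sites in the cube `[-k, k]³`. -/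
def mask (k : ℤ) (l : List Site) : ℕ := l.foldr (fun y m => 1 <<< bitIndex k y ||| m) 0

theorem bitIndex_injOn : Set.InjOn (bitIndex 8) {y | InCube 7 y} := by
  intro x hx y hy h
  simp only [Set.mem_ofPred_eq, InCube, abs_le] at hx hy
  have hx₀ := hx 0
  have hx₁ := hx 1
  have hx₂ := hx 2
  have hy₀ := hy 0
  have hy₁ := hy 1
  have hy₂ := hy 2
  unfold bitIndex at h
  ext l
  fin_cases l <;> simp only [Fin.zero_eta, Fin.mk_one, Fin.reduceFinMk] <;> omega

theorem bitIndex_add {m n : ℤ} {x y : Site} (hx : InCube m x) (hy : InCube n y) :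
    bitIndex m x + bitIndex n y = bitIndex (m + n) (x + y) := by
  simp only [InCube, abs_le] at hx hy
  have hx₀ := hx 0
  have hx₁ := hx 1
  have hx₂ := hx 2
  have hy₀ := hy 0
  have hy₁ := hy 1
  have hy₂ := hy 2
  simp only [bitIndex, Pi.add_apply]
  omega

theorem testBit_mask {k : ℤ} {l : List Site} {i : ℕ} :
    (mask k l).testBit i = true ↔ ∃ y ∈ l, bitIndex k y = i := by
  induction l with
  | nil => simp [mask]
  | cons a l ih =>
    have hcons : mask k (a :: l) = 1 <<< bitIndex k a ||| mask k l := rfl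
    simp [hcons, Nat.testBit_or, Nat.one_shiftLeft, Nat.testBit_two_pow, ih]

theorem mask_shiftLeft {j k : ℤ} {x : Site} {l : List Site} (hx : InCube j x)
    (hl : ∀ y ∈ l, InCube k y) : mask k l <<< bitIndex j x = mask (j + k) (l.map (x + ·)) := by
  induction l with
  | nil => exact Nat.zero_shiftLeft _
  | cons a l ih =>
    obtain ⟨ha, hl⟩ := List.forall_mem_cons.1 hl
    change (1 <<< bitIndex k a ||| mask k l) <<< bitIndex j x =
      1 <<< bitIndex (j + k) (x + a) ||| mask (j + k) (l.map (x + ·))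
    rw [Nat.shiftLeft_or_distrib, ← Nat.shiftLeft_add, add_comm (bitIndex k a), bitIndex_add hx ha,
      ih hl]

/-- The bits of `occ` are positions, in the cube `[-8, 8]³`, of sites of `φ`. -/
def Marks (occ : ℕ) (φ : Set Site) : Prop :=
  ∀ i, occ.testBit i = true → ∃ y ∈ φ, InCube 7 y ∧ bitIndex 8 y = i

theorem Marks.or {φ : Set Site} {m n : ℕ} (hm : Marks m φ) (hn : Marks n φ) :
    Marks (m ||| n) φ := fun i hi => by
  rw [Nat.testBit_or, Bool.or_eq_true] at hi
  exact hi.elim (hm i) (hn i)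

theorem marks_mask {φ : Set Site} {l : List Site} (hcube : ∀ y ∈ l, InCube 7 y)
    (hφ : ∀ y ∈ l, y ∈ φ) : Marks (mask 8 l) φ := fun i hi => by
  obtain ⟨y, hy, rfl⟩ := testBit_mask.1 hi
  exact ⟨y, hφ y hy, hcube y hy, rfl⟩

theorem Marks.mem {φ : Set Site} {occ : ℕ} (h : Marks occ φ) {y : Site} (hy : InCube 7 y)
    (hbit : occ.testBit (bitIndex 8 y) = true) : y ∈ φ := by
  obtain ⟨z, hzφ, hz, heq⟩ := h _ hbit
  rwa [← bitIndex_injOn hz hy heq]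

theorem Marks.subset_of_land_eq {φ : Set Site} {occ : ℕ} (h : Marks occ φ) {l : List Site}
    (hl : ∀ y ∈ l, InCube 7 y) (hland : mask 8 l &&& occ = mask 8 l) : ∀ y ∈ l, y ∈ φ := by
  intro y hy
  have hbit := (testBit_mask (k := 8)).2 ⟨y, hy, rfl⟩
  rw [← hland, Nat.testBit_and, Bool.and_eq_true] at hbit
  exact h.mem (hl y hy) hbit.2

theorem Marks.mask_land_eq_zero {φ : Set Site} {occ : ℕ} (h : Marks occ φ) {l : List Site}
    (hl : ∀ y ∈ l, InCube 7 y) (hφ : ∀ y ∈ l, y ∉ φ) : mask 8 l &&& occ = 0 := by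
  by_contra! hne
  obtain ⟨i, hi⟩ := Nat.exists_testBit_of_ne_zero hne
  rw [Nat.testBit_and, Bool.and_eq_true] at hi
  obtain ⟨y, hy, rfl⟩ := testBit_mask.1 hi.1
  exact hφ y hy (h.mem (hl y hy) hi.2)

/-- The bit mask of the punctured ball around the origin. -/
def nearMask : ℕ := mask 2 ballSites.tail

/-- The bit mask, in the cube `[-4, 4]³`, of the sites that cannot be occupied together with all the
sites of `l`. -/
def conflictMask (l : List Site) : ℕ :=
  l.foldr (fun y m => nearMask <<< bitIndex 2 y ||| m) 0

theorem ballSites_tail_spec :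
    ∀ q ∈ ballSites.tail, q ≠ 0 ∧ sqDist 0 q < 6 ∧ InCube 2 q := by decide +kernel

section Marks

variable {φ : Set Site} {occ : ℕ} (hφ : Admissible 6 φ) (hocc : Marks occ φ)

include hφ hocc

theorem Marks.nearMask_land_eq_zero {x p : Site} (hx : InCube 1 x) (hp : InCube 2 p)
    (hmem : x + p ∈ φ) : nearMask <<< bitIndex 2 p <<< bitIndex 4 x &&& occ = 0 := by
  have hnear (q : Site) (hq : q ∈ ballSites.tail) : InCube 4 (p + q) :=
    hp.add (ballSites_tail_spec q hq).2.2
  rw [nearMask, mask_shiftLeft hp fun q hq => (ballSites_tail_spec q hq).2.2,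
    mask_shiftLeft (k := 2 + 2) (hx.mono (by norm_num)) (List.forall_mem_map.2 hnear)]
  refine hocc.mask_land_eq_zero ?_ ?_ <;> simp only [List.forall_mem_map] <;> intro q hq
  · exact (hx.add (hnear q hq)).mono (by norm_num)
  · obtain ⟨hne, hlt, -⟩ := ballSites_tail_spec q hq
    rw [← add_assoc]
    refine fun hqφ => hne (left_eq_add.1 (hφ.eq_of_sqDist_lt hmem hqφ ?_))
    rwa [sqDist_self_add]

theorem Marks.conflictMask_land_eq_zero {x : Site} {P : List Site} (hx : InCube 1 x)
    (hP : ∀ p ∈ P, InCube 2 p) (hmem : ∀ p ∈ P, x + p ∈ φ) :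
    conflictMask P <<< bitIndex 4 x &&& occ = 0 := by
  induction P with
  | nil => simp [conflictMask]
  | cons p P ih =>
    obtain ⟨hp, hP⟩ := List.forall_mem_cons.1 hP
    obtain ⟨hpφ, hPφ⟩ := List.forall_mem_cons.1 hmem
    change (nearMask <<< bitIndex 2 p ||| conflictMask P) <<< bitIndex 4 x &&& occ = 0
    rw [Nat.shiftLeft_or_distrib, Nat.and_or_distrib_right, ih hP hPφ,
      hocc.nearMask_land_eq_zero hφ hx hp hpφ, Nat.or_self]

end Marks

theorem Marks.mask_shiftLeft_or {φ : Set Site} {occ : ℕ} (hocc : Marks occ φ) {x : Site}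
    {P : List Site} (hx : InCube 1 x) (hP : ∀ p ∈ P, InCube 2 p) (hmem : ∀ p ∈ P, x + p ∈ φ) :
    Marks (mask 4 P <<< bitIndex 4 x ||| occ) φ := by
  rw [mask_shiftLeft (hx.mono (by norm_num)) fun p hp => (hP p hp).mono (by norm_num)]
  refine (marks_mask ?_ (List.forall_mem_map.2 hmem)).or hocc
  exact List.forall_mem_map.2 fun p hp => (hx.add (hP p hp)).mono (by norm_num)

/-- Some list of `goals` is marked in `occ`. -/
def reaches (goals : List ℕ) (occ : ℕ) : Bool := goals.any fun g => (g &&& occ).beq g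

/-- If true, every admissible set that contains the sites marked in `occ` and for which the
potential is greatest at each of the sites `hs` contains the sites marked in one of `goals`. The
search branches over the optimal sets around the sites `hs`, one after the other. -/
def resolves (goals : List ℕ) : List Site → ℕ → Bool
  | [], occ => reaches goals occ
  | x :: hs, occ => reaches goals occ || optimalGroups.all fun q =>
      !(nearMask <<< bitIndex 2 q.1 <<< bitIndex 4 x &&& occ).beq 0 || q.2.all fun P =>
        !(conflictMask P <<< bitIndex 4 x &&& occ).beq 0 ||
          resolves goals hs (mask 4 (q.1 :: P) <<< bitIndex 4 x ||| occ)

theorem Marks.exists_subset_of_reaches {φ : Set Site} {occ : ℕ} (hocc : Marks occ φ)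
    {goals : List (List Site)} (hgoals : ∀ G ∈ goals, ∀ y ∈ G, InCube 7 y)
    (h : reaches (goals.map (mask 8)) occ = true) : ∃ G ∈ goals, ∀ y ∈ G, y ∈ φ := by
  simp only [reaches, List.any_map, List.any_eq_true, Function.comp_apply, Nat.beq_eq] at h
  obtain ⟨G, hG, hland⟩ := h
  exact ⟨G, hG, hocc.subset_of_land_eq (hgoals G hG) hland⟩

theorem IsPerfect.exists_subset_of_resolves {φ : Set Site} (hφ : IsPerfect φ)
    {goals : List (List Site)} (hgoals : ∀ G ∈ goals, ∀ y ∈ G, InCube 7 y) {hs : List Site}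
    (hhs : ∀ x ∈ hs, InCube 1 x) {occ : ℕ} (hocc : Marks occ φ)
    (h : resolves (goals.map (mask 8)) hs occ = true) : ∃ G ∈ goals, ∀ y ∈ G, y ∈ φ := by
  induction hs generalizing occ with
  | nil => exact hocc.exists_subset_of_reaches hgoals h
  | cons x hs ih =>
    obtain ⟨hx, hhs⟩ := List.forall_mem_cons.1 hhs
    rw [resolves, Bool.or_eq_true] at h
    refine h.elim (hocc.exists_subset_of_reaches hgoals) fun h => ?_
    obtain ⟨P, hP, hPφ⟩ := hφ.exists_optimalSet x
    have hcube := (optimalSets_spec P hP).1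
    obtain ⟨q, hq, R, hR, rfl⟩ := mem_optimalSets.1 hP
    have hfirst := hocc.nearMask_land_eq_zero hφ.1 hx (hcube q.1 List.mem_cons_self)
      (hPφ q.1 List.mem_cons_self)
    have hrest := hocc.conflictMask_land_eq_zero hφ.1 hx (List.forall_mem_cons.1 hcube).2
      (List.forall_mem_cons.1 hPφ).2
    have hq := List.all_eq_true.1 h q hq
    rw [hfirst, Nat.beq_refl, Bool.not_true, Bool.false_or] at hq
    have hR := List.all_eq_true.1 hq R hR
    rw [hrest, Nat.beq_refl, Bool.not_true, Bool.false_or] at hR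
    exact ih hhs (hocc.mask_shiftLeft_or hx hcube hPφ) hR

theorem IsPerfect.preimage_add {φ : Set Site} (hφ : IsPerfect φ) (x : Site) :
    IsPerfect ((x + ·) ⁻¹' φ) := by
  obtain ⟨hadm, hpot⟩ := isPerfect_iff_potential.1 hφ
  refine isPerfect_iff_potential.2 ⟨hadm.preimage_add x, fun y => ?_⟩
  rw [potential_eq_weightIn, ← hpot (x + y), potential_eq_weightIn, Set.preimage_preimage]
  simp only [add_assoc]

/-- Sites around the origin, in an order for which the searches below end quickly. -/
def hintSites : List Site :=
  [![1, 0, 0], ![-1, 0, 0], ![0, 1, 0], ![0, -1, 0], ![0, 0, 1], ![0, 0, -1],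
   ![1, 1, 0], ![1, -1, 0], ![-1, 1, 0], ![-1, -1, 0], ![1, 0, 1], ![1, 0, -1], ![-1, 0, 1],
   ![-1, 0, -1], ![0, 1, 1], ![0, 1, -1], ![0, -1, 1], ![0, -1, -1]]

theorem inCube_hintSites : ∀ x ∈ hintSites, InCube 1 x := by decide +kernel

/-- If true, perfect configurations that contain `base` contain one of `goals`, by a search around
the origin. -/
def searchForces (base : List Site) (goals : List (List Site)) : Bool :=
  (base :: goals).all (·.all (InCube 7 ·)) &&
    resolves (goals.map (mask 8)) hintSites (mask 8 base)

/-- Perfect configurations that contain a translate of `base` contain the same translate of one of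
`goals`. -/
def Forces (base : List Site) (goals : List (List Site)) : Prop :=
  ∀ φ, IsPerfect φ → ∀ x, (∀ y ∈ base, x + y ∈ φ) → ∃ G ∈ goals, ∀ y ∈ G, x + y ∈ φ

theorem forces_of_searchForces {base : List Site} {goals : List (List Site)}
    (h : searchForces base goals = true) : Forces base goals := by
  intro φ hφ x hbase
  simp only [searchForces, Bool.and_eq_true, List.all_eq_true, decide_eq_true_eq] at h
  obtain ⟨hcube, hres⟩ := h
  obtain ⟨hbase_cube, hgoals⟩ := List.forall_mem_cons.1 hcube
  exact (hφ.preimage_add x).exists_subset_of_resolves hgoals inCube_hintSites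
    (marks_mask hbase_cube hbase) hres

/-! ### Layer systems -/

/-- A plane lattice of sites together with the steps by which the layers parallel to it may be
stacked. The lattice is given by `normal ⬝ᵥ z = 0` and `modulus ∣ label ⬝ᵥ z`; the sites
`j • r₀ + i • r₁` with `0 ≤ j < spacing` and `0 ≤ i < modulus` represent all sites modulo the
lattice and any one of the steps. -/
structure LayerSystem where
  normal : Site
  spacing : ℤ
  label : Site
  modulus : ℤ
  gen₁ : Site
  gen₂ : Site
  r₀ : Site
  r₁ : Site
  steps : List Site
  spacing_pos : 0 < spacing
  modulus_pos : 0 < modulus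
  normal_r₀ : normal ⬝ᵥ r₀ = 1
  label_r₀ : label ⬝ᵥ r₀ = 0
  normal_r₁ : normal ⬝ᵥ r₁ = 0
  label_r₁ : label ⬝ᵥ r₁ = 1
  normal_step : ∀ u ∈ steps, normal ⬝ᵥ u = spacing
  gen₁_mem : normal ⬝ᵥ gen₁ = 0 ∧ modulus ∣ label ⬝ᵥ gen₁
  gen₂_mem : normal ⬝ᵥ gen₂ = 0 ∧ modulus ∣ label ⬝ᵥ gen₂
  exists_coeff : ∀ z, normal ⬝ᵥ z = 0 → modulus ∣ label ⬝ᵥ z → ∃ a b : ℤ, z = a • gen₁ + b • gen₂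

theorem site_ext {x y : Site} (h₀ : x 0 = y 0) (h₁ : x 1 = y 1) (h₂ : x 2 = y 2) : x = y := by
  ext l
  fin_cases l <;> assumption

/-- The main diagonals. -/
def triNormal : Fin 4 → Site := ![![1, 1, 1], ![1, -1, 1], ![1, -1, -1], ![1, 1, -1]]

/-- The triangular layers orthogonal to a main diagonal. -/
def triSystem (i : Fin 4) : LayerSystem where
  normal := triNormal i
  spacing := 4
  label := ![1, -triNormal i 1, 0]
  modulus := 3
  gen₁ := ![1, -2 * triNormal i 1, triNormal i 2]
  gen₂ := ![-1, -triNormal i 1, 2 * triNormal i 2]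
  r₀ := ![0, 0, triNormal i 2]
  r₁ := ![0, -triNormal i 1, triNormal i 2]
  steps := [![1, triNormal i 1, 2 * triNormal i 2], ![1, 2 * triNormal i 1, triNormal i 2],
    ![2, triNormal i 1, triNormal i 2]]
  spacing_pos := by norm_num
  modulus_pos := by norm_num
  normal_r₀ := by revert i; decide
  label_r₀ := by revert i; decide
  normal_r₁ := by revert i; decide
  label_r₁ := by revert i; decide
  normal_step := by revert i; decide
  gen₁_mem := by revert i; decide
  gen₂_mem := by revert i; decide
  exists_coeff := by
    rintro z hz ⟨t, ht⟩
    refine ⟨t, t - z 0, ?_⟩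
    fin_cases i <;> simp [triNormal, Matrix.vecHead, Matrix.vecTail] at hz ht <;>
      apply site_ext <;> simp [triNormal] <;> omega

/-- The non-main diagonals. -/
def rhoNormal : Fin 6 → Site :=
  ![![1, 1, 0], ![-1, 1, 0], ![1, 0, 1], ![-1, 0, 1], ![0, 1, 1], ![0, -1, 1]]

/-- The vector `a` of the rhombic family. -/
def rhoAxis : Fin 6 → Site :=
  ![![0, 0, 1], ![0, 0, 1], ![0, 1, 0], ![0, 1, 0], ![1, 0, 0], ![1, 0, 0]]

/-- The vector `2b` of the rhombic family. -/
def rhoCross : Fin 6 → Site :=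
  ![![1, -1, 0], ![1, 1, 0], ![-1, 0, 1], ![-1, 0, -1], ![0, 1, -1], ![0, 1, 1]]

/-- The rhombic layers orthogonal to a non-main diagonal. All divisions by `2` are exact. -/
def rhoSystem (i : Fin 6) : LayerSystem where
  normal := rhoNormal i
  spacing := 3
  label := rhoAxis i + rhoCross i
  modulus := 4
  gen₁ := 2 • rhoAxis i + rhoCross i
  gen₂ := 2 • rhoAxis i - rhoCross i
  r₀ := fun l => rhoAxis i l + (rhoNormal i l - rhoCross i l) / 2
  r₁ := rhoAxis i
  steps := [fun l => rhoAxis i l + (3 * rhoNormal i l + rhoCross i l) / 2,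
    fun l => rhoAxis i l + (3 * rhoNormal i l - rhoCross i l) / 2]
  spacing_pos := by norm_num
  modulus_pos := by norm_num
  normal_r₀ := by revert i; decide
  label_r₀ := by revert i; decide
  normal_r₁ := by revert i; decide
  label_r₁ := by revert i; decide
  normal_step := by revert i; decide
  gen₁_mem := by revert i; decide
  gen₂_mem := by revert i; decide
  exists_coeff := by
    rintro z hz ⟨t, ht⟩
    refine ⟨t, t - (rhoCross i ⬝ᵥ z) / 2, ?_⟩
    fin_cases i <;> simp [rhoNormal, rhoAxis, rhoCross, Matrix.vecHead, Matrix.vecTail] at hz ht <;>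
      apply site_ext <;> simp [rhoAxis, rhoCross, Matrix.vecHead, Matrix.vecTail] <;> omega

/-- All layer systems: the triangular and the rhombic ones. -/
def systems : List LayerSystem := List.ofFn triSystem ++ List.ofFn rhoSystem

theorem mem_systems {S : LayerSystem} :
    S ∈ systems ↔ (∃ i, triSystem i = S) ∨ ∃ i, rhoSystem i = S := by
  rw [systems, List.mem_append, List.mem_ofFn, List.mem_ofFn]

theorem triSystem_mem_systems (i : Fin 4) : triSystem i ∈ systems := mem_systems.2 (.inl ⟨i, rfl⟩)

/-- The sites at squared distance `6` from the origin. -/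
def shell : List Site :=
  [![1, 1, 2], ![1, 1, -2], ![1, -1, 2], ![1, -1, -2], ![-1, 1, 2], ![-1, 1, -2], ![-1, -1, 2],
   ![-1, -1, -2], ![1, 2, 1], ![1, -2, 1], ![1, 2, -1], ![1, -2, -1], ![-1, 2, 1], ![-1, -2, 1],
   ![-1, 2, -1], ![-1, -2, -1], ![2, 1, 1], ![-2, 1, 1], ![2, 1, -1], ![-2, 1, -1], ![2, -1, 1],
   ![-2, -1, 1], ![2, -1, -1], ![-2, -1, -1]]

namespace LayerSystem

variable {S : LayerSystem}

/-- The layer through the origin. -/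
def lattice (S : LayerSystem) : AddSubgroup Site where
  carrier := {z | S.normal ⬝ᵥ z = 0 ∧ S.modulus ∣ S.label ⬝ᵥ z}
  zero_mem' := by simp
  add_mem' := fun ⟨hy, hy'⟩ ⟨hz, hz'⟩ =>
    ⟨by rw [dotProduct_add, hy, hz, add_zero], by rw [dotProduct_add]; exact dvd_add hy' hz'⟩
  neg_mem' := fun ⟨hz, hz'⟩ =>
    ⟨by rw [dotProduct_neg, hz, neg_zero], by rwa [dotProduct_neg, dvd_neg]⟩

instance (S : LayerSystem) : DecidablePred (· ∈ S.lattice) := fun _ =>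
  inferInstanceAs (Decidable (_ ∧ _))

/-- The sites at squared distance `6` from the origin in the layer through `u`. -/
def star (S : LayerSystem) (u : Site) : List Site := shell.filter fun v => v - u ∈ S.lattice

/-- The origin and the sites at squared distance `6` from it in the layers through `0`, `u`
and `-d`. -/
def nbhd (S : LayerSystem) (u d : Site) : List Site := 0 :: (S.star 0 ++ S.star u ++ S.star (-d))

/-- Generators of the lattice as a monoid. -/
def gens (S : LayerSystem) : List Site := [S.gen₁, S.gen₂, -S.gen₁, -S.gen₂]

theorem gens_subset_lattice : ∀ g ∈ S.gens, g ∈ S.lattice := by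
  have h₁ : S.gen₁ ∈ S.lattice := S.gen₁_mem
  have h₂ : S.gen₂ ∈ S.lattice := S.gen₂_mem
  simp [gens, h₁, h₂]

theorem star_zero_subset_lattice : ∀ v ∈ S.star 0, v ∈ S.lattice := fun v hv => by
  simpa using (List.mem_filter.1 hv).2

theorem gens_subset_nbhd (hS : S ∈ systems) (u d : Site) : ∀ g ∈ S.gens, g ∈ S.nbhd u d := by
  have hstar : ∀ S ∈ systems, ∀ g ∈ S.gens, g ∈ S.star 0 := by decide +kernel
  simp only [nbhd, List.mem_cons, List.mem_append]
  exact fun g hg => .inr (.inl (.inl (hstar S hS g hg)))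

theorem lattice_induction {P : Site → Prop} {x : Site} (hx : P x)
    (h : ∀ y, ∀ g ∈ S.gens, P y → P (y + g)) {z : Site} (hz : z ∈ S.lattice) : P (x + z) := by
  have hzsmul {y g : Site} (hg : g ∈ S.gens) (hg' : -g ∈ S.gens) (hy : P y) (n : ℤ) :
      P (y + n • g) := by
    induction n using Int.induction_on with
    | zero => simpa using hy
    | succ k ih => simpa [add_smul, add_assoc] using h _ g hg ih
    | pred k ih =>
      rw [sub_smul, one_smul, sub_eq_add_neg, ← add_assoc]
      exact h _ (-g) hg' ih
  obtain ⟨a, b, rfl⟩ := S.exists_coeff z hz.1 hz.2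
  rw [← add_assoc]
  exact hzsmul (by simp [gens]) (by simp [gens]) (hzsmul (by simp [gens]) (by simp [gens]) hx a) b

end LayerSystem

/-! ### Perfect configurations contain a stack of layers -/

/-- The neighborhoods of the layer systems between two different steps. -/
def rigidNbhds : List (List Site) :=
  systems.flatMap fun S => S.steps.flatMap fun u => (S.steps.filter (· ≠ u)).map fun d => S.nbhd u d

/-- The neighborhoods of the triangular layer systems between two equal steps. -/
def latticeNbhds : List (List Site) :=
  (List.ofFn triSystem).flatMap fun S => S.steps.map fun u => S.nbhd u u

theorem mem_rigidNbhds {G : List Site} : G ∈ rigidNbhds ↔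
    ∃ S ∈ systems, ∃ u ∈ S.steps, ∃ d ∈ S.steps, d ≠ u ∧ S.nbhd u d = G := by
  simp [rigidNbhds, and_assoc]

theorem mem_latticeNbhds {G : List Site} : G ∈ latticeNbhds ↔
    ∃ i, ∃ u ∈ (triSystem i).steps, (triSystem i).nbhd u u = G := by
  simp only [latticeNbhds, List.mem_flatMap, List.mem_ofFn, List.mem_map, exists_exists_eq_and]

set_option maxRecDepth 100000 in
-- A single declaration, because the kernel evaluates `optimalGroups` anew in each declaration.
theorem searches_succeed :
    searchForces [0] (rigidNbhds ++ latticeNbhds) = true ∧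
    (∀ S ∈ systems, ∀ u ∈ S.steps, ∀ d ∈ S.steps, d ≠ u → ∀ g ∈ S.gens,
      searchForces ((S.nbhd u d).map (· - g)) [S.nbhd u d] = true) ∧
    (∀ i, ∀ u ∈ (triSystem i).steps, ∀ g ∈ (triSystem i).gens,
      searchForces (((triSystem i).nbhd u u).map (· - g))
        ((triSystem i).nbhd u u :: rigidNbhds) = true) ∧
    ∀ S ∈ systems, ∀ us ∈ [S.steps, S.steps.map (-·)],
      searchForces (0 :: S.star 0) (us.map ([·])) = true ∧ ∀ u ∈ us, ∀ g ∈ S.gens,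
        searchForces ((u :: (0 :: S.star 0) ++ (0 :: S.star 0).map (g + ·)).map (· - g))
          [[u]] = true := by
  decide +kernel

theorem forces_nbhd : Forces [0] (rigidNbhds ++ latticeNbhds) :=
  forces_of_searchForces searches_succeed.1

theorem Forces.exists_add {l : List Site} {g : Site} {goals : List (List Site)} {φ : Set Site}
    (h : Forces (l.map (· - g)) goals) (hφ : IsPerfect φ) {x : Site} (hl : ∀ v ∈ l, x + v ∈ φ) :
    ∃ G ∈ goals, ∀ v ∈ G, x + g + v ∈ φ :=
  h φ hφ (x + g) (List.forall_mem_map.2 fun v hv => by rw [add_add_sub_cancel]; exact hl v hv)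

namespace LayerSystem

variable {S : LayerSystem} {φ : Set Site}

theorem forces_nbhd_of_ne (hS : S ∈ systems) {u d g : Site} (hu : u ∈ S.steps) (hd : d ∈ S.steps)
    (hne : d ≠ u) (hg : g ∈ S.gens) : Forces ((S.nbhd u d).map (· - g)) [S.nbhd u d] :=
  forces_of_searchForces (searches_succeed.2.1 S hS u hu d hd hne g hg)

theorem forces_nbhd_self {i : Fin 4} {u g : Site} (hu : u ∈ (triSystem i).steps)
    (hg : g ∈ (triSystem i).gens) :
    Forces (((triSystem i).nbhd u u).map (· - g)) ((triSystem i).nbhd u u :: rigidNbhds) :=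
  forces_of_searchForces (searches_succeed.2.2.1 i u hu g hg)

theorem forces_step (hS : S ∈ systems) {us : List Site} (hus : us ∈ [S.steps, S.steps.map (-·)]) :
    Forces (0 :: S.star 0) (us.map ([·])) :=
  forces_of_searchForces (searches_succeed.2.2.2 S hS us hus).1

theorem forces_step_spread (hS : S ∈ systems) {us : List Site}
    (hus : us ∈ [S.steps, S.steps.map (-·)]) {u g : Site} (hu : u ∈ us) (hg : g ∈ S.gens) :
    Forces ((u :: (0 :: S.star 0) ++ (0 :: S.star 0).map (g + ·)).map (· - g)) [[u]] :=
  forces_of_searchForces ((searches_succeed.2.2.2 S hS us hus).2 u hu g hg)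

/-- The layer through `x` is contained in `φ`. -/
def HasLayer (S : LayerSystem) (φ : Set Site) (x : Site) : Prop := ∀ z ∈ S.lattice, x + z ∈ φ

theorem HasLayer.add {x : Site} (h : S.HasLayer φ x) {z : Site} (hz : z ∈ S.lattice) :
    S.HasLayer φ (x + z) := fun w hw => by
  rw [add_assoc]
  exact h _ (add_mem hz hw)

theorem HasLayer.add_mem_of_mem_star {x : Site} (h : S.HasLayer φ x) :
    ∀ v ∈ 0 :: S.star 0, x + v ∈ φ := fun v hv =>
  h v <| (List.mem_cons.1 hv).elim (· ▸ zero_mem _) (star_zero_subset_lattice v)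

theorem hasLayer_of_nbhd_spread (hS : S ∈ systems) {u d x : Site}
    (hx : ∀ v ∈ S.nbhd u d, x + v ∈ φ)
    (hspread : ∀ y, (∀ v ∈ S.nbhd u d, y + v ∈ φ) → ∀ g ∈ S.gens, y + g ∈ φ →
      ∀ v ∈ S.nbhd u d, y + g + v ∈ φ) : S.HasLayer φ x := fun z hz => by
  have h := lattice_induction (P := fun y => ∀ v ∈ S.nbhd u d, y + v ∈ φ) hx
    (fun y g hg hy => hspread y hy g hg (hy g (gens_subset_nbhd hS u d g hg))) hz
  simpa using h 0 List.mem_cons_self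

theorem hasLayer_of_rigidNbhd (hφ : IsPerfect φ) {x : Site} {G : List Site} (hG : G ∈ rigidNbhds)
    (hx : ∀ v ∈ G, x + v ∈ φ) : ∃ S ∈ systems, S.HasLayer φ x := by
  obtain ⟨S, hS, u, hu, d, hd, hne, rfl⟩ := mem_rigidNbhds.1 hG
  refine ⟨S, hS, hasLayer_of_nbhd_spread hS hx fun y hy g hg _ => ?_⟩
  simpa using (forces_nbhd_of_ne hS hu hd hne hg).exists_add hφ hy

theorem exists_hasLayer (hφ : IsPerfect φ) : ∃ S ∈ systems, ∃ x, S.HasLayer φ x := by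
  by_cases! hrigid : ∃ x ∈ φ, ∃ G ∈ rigidNbhds, ∀ v ∈ G, x + v ∈ φ
  · obtain ⟨x, -, G, hG, hx⟩ := hrigid
    obtain ⟨S, hS, h⟩ := hasLayer_of_rigidNbhd hφ hG hx
    exact ⟨S, hS, x, h⟩
  · obtain ⟨x, -, hx⟩ := hφ.exists_mem_ball 0
    have hnot (y : Site) (hy : y ∈ φ) : ¬∃ G ∈ rigidNbhds, ∀ v ∈ G, y + v ∈ φ := by
      push Not
      exact hrigid y hy
    obtain ⟨G, hG, hGφ⟩ := forces_nbhd φ hφ x (by simpa using hx)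
    obtain ⟨i, u, hu, rfl⟩ := mem_latticeNbhds.1 <|
      (List.mem_append.1 hG).resolve_left fun hG => hnot x hx ⟨G, hG, hGφ⟩
    refine ⟨_, triSystem_mem_systems i, x,
      hasLayer_of_nbhd_spread (triSystem_mem_systems i) hGφ fun y hy g hg hyg => ?_⟩
    obtain ⟨G, hG, hGφ⟩ := (forces_nbhd_self hu hg).exists_add hφ hy
    rcases List.mem_cons.1 hG with rfl | hG
    · exact hGφ
    · exact absurd ⟨G, hG, hGφ⟩ (hnot _ hyg)

theorem HasLayer.exists_step (hS : S ∈ systems) (hφ : IsPerfect φ) {us : List Site}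
    (hus : us ∈ [S.steps, S.steps.map (-·)]) {x : Site} (hx : S.HasLayer φ x) :
    ∃ u ∈ us, S.HasLayer φ (x + u) := by
  obtain ⟨G, hG, hGφ⟩ := forces_step hS hus φ hφ x hx.add_mem_of_mem_star
  obtain ⟨u, hu, rfl⟩ := List.mem_map.1 hG
  refine ⟨u, hu, fun z hz => ?_⟩
  rw [add_right_comm]
  refine (lattice_induction (P := fun y => S.HasLayer φ y ∧ y + u ∈ φ)
    ⟨hx, hGφ u List.mem_cons_self⟩ (fun y g hg ⟨hy, hyu⟩ => ?_) hz).2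
  have hyg := hy.add (gens_subset_lattice g hg)
  refine ⟨hyg, ?_⟩
  have hbase : ∀ v ∈ u :: (0 :: S.star 0) ++ (0 :: S.star 0).map (g + ·), y + v ∈ φ := by
    refine List.forall_mem_append.2 ⟨List.forall_mem_cons.2 ⟨hyu, hy.add_mem_of_mem_star⟩, ?_⟩
    refine List.forall_mem_map.2 fun v hv => ?_
    rw [← add_assoc]
    exact hyg.add_mem_of_mem_star v hv
  simpa using (forces_step_spread hS hus hu hg).exists_add hφ hbase

theorem HasLayer.exists_succ (hS : S ∈ systems) (hφ : IsPerfect φ) {x : Site}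
    (hx : S.HasLayer φ x) : ∃ y, S.HasLayer φ y ∧ y - x ∈ S.steps := by
  obtain ⟨u, hu, h⟩ := hx.exists_step hS hφ List.mem_cons_self
  exact ⟨x + u, h, by rwa [add_sub_cancel_left]⟩

theorem HasLayer.exists_pred (hS : S ∈ systems) (hφ : IsPerfect φ) {y : Site}
    (hy : S.HasLayer φ y) : ∃ x, S.HasLayer φ x ∧ y - x ∈ S.steps := by
  obtain ⟨u, hu, h⟩ := hy.exists_step hS hφ (List.mem_cons_of_mem _ List.mem_cons_self)
  obtain ⟨v, hv, rfl⟩ := List.mem_map.1 hu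
  exact ⟨y + -v, h, by simpa using hv⟩

end LayerSystem

theorem exists_int_path {α : Type*} {r : ℤ → α → α → Prop} (hsucc : ∀ k x, ∃ y, r k x y)
    (hpred : ∀ k y, ∃ x, r k x y) (x : α) : ∃ p : ℤ → α, p 0 = x ∧ ∀ k, r k (p k) (p (k + 1)) := by
  choose f hf using hsucc
  choose b hb using hpred
  refine ⟨fun
    | .ofNat n => n.rec x fun n => f n
    | .negSucc n => n.rec (b (-1) x) fun n => b (.negSucc (n + 1)), rfl, ?_⟩
  rintro (n | _ | n)
  · exact hf n _
  · exact hb (-1) x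
  · exact hb (.negSucc (n + 1)) _

namespace LayerSystem

/-- The union of the layers through the points `p k`. -/
def layers (S : LayerSystem) (p : ℤ → Site) : Set Site := {y | ∃ k, y - p k ∈ S.lattice}

/-- Successive points differ by a step of the layer system. -/
def IsPath (S : LayerSystem) (p : ℤ → Site) : Prop := ∀ k, p (k + 1) - p k ∈ S.steps

end LayerSystem

theorem IsPerfect.exists_layers_subset {φ : Set Site} (hφ : IsPerfect φ) :
    ∃ S ∈ systems, ∃ p, S.IsPath p ∧ S.layers p ⊆ φ := by
  obtain ⟨S, hS, x, hx⟩ := LayerSystem.exists_hasLayer hφ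
  obtain ⟨p, -, hp⟩ := exists_int_path
    (r := fun _ (x y : {x // S.HasLayer φ x}) => y.1 - x.1 ∈ S.steps)
    (fun _ x => by simpa using x.2.exists_succ hS hφ)
    (fun _ y => by simpa using y.2.exists_pred hS hφ) ⟨x, hx⟩
  refine ⟨S, hS, fun k => (p k).1, hp, ?_⟩
  rintro y ⟨k, hk⟩
  simpa using (p k).2 _ hk

/-! ### Layers are perfect -/

theorem neg_mem_ballSites {q : Site} (hq : q ∈ ballSites) : -q ∈ ballSites := by
  rw [mem_ballSites] at hq ⊢
  rwa [← zero_sub, sqDist_sub, zero_add, sqDist_comm]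

theorem sum_filter_le_weightIn {α : Type*} {w : α → ℕ} {φ : Set α} {P : α → Prop} [DecidablePred P]
    {l : List α} (h : ∀ p, P p → p ∈ φ) : ((l.filter P).map w).sum ≤ weightIn w φ l := by
  induction l with
  | nil => simp
  | cons a l ih =>
    by_cases ha : P a
    · rw [List.filter_cons_of_pos (by simpa), weightIn_cons_of_mem _ (h a ha), List.map_cons,
        List.sum_cons]
      gcongr
    · rw [List.filter_cons_of_neg (by simpa)]
      exact ih.trans (Nat.le_add_left _ _)

theorem eq_of_int_recursion {α : Type*} {f : ℤ → α → α} (hf : ∀ k, (f k).Injective) {a b : ℤ → α}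
    (h₀ : a 0 = b 0) (ha : ∀ k, a (k + 1) = f k (a k)) (hb : ∀ k, b (k + 1) = f k (b k)) :
    a = b := by
  funext k
  induction k using Int.induction_on with
  | zero => exact h₀
  | succ k ih => rw [ha, hb, ih]
  | pred k ih =>
    apply hf (-k - 1)
    rw [← ha, ← hb, sub_add_cancel, ih]

namespace LayerSystem

variable {S : LayerSystem} {p : ℤ → Site}

theorem IsPath.dotProduct_eq (hp : S.IsPath p) (k : ℤ) :
    S.normal ⬝ᵥ p k = S.normal ⬝ᵥ p 0 + S.spacing * k := by
  refine congrFun (eq_of_int_recursion (a := fun k => S.normal ⬝ᵥ p k)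
    (b := fun k => S.normal ⬝ᵥ p 0 + S.spacing * k) (fun _ => add_left_injective S.spacing)
    (by simp) (fun k => ?_) fun k => by ring) k
  simp only [← S.normal_step _ (hp k), dotProduct_sub, add_sub_cancel]

theorem IsPath.dotProduct_of_sub_mem_lattice (hp : S.IsPath p) {k : ℤ} {y : Site}
    (hy : y - p k ∈ S.lattice) : S.normal ⬝ᵥ y = S.normal ⬝ᵥ p 0 + S.spacing * k := by
  rw [← hp.dotProduct_eq, ← sub_eq_zero, ← dotProduct_sub]
  exact hy.1

theorem separation : ∀ S ∈ systems, ∀ q ∈ ballSites, |S.normal ⬝ᵥ q| < 2 * S.spacing ∧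
    (q ∈ S.lattice → q = 0) ∧ ∀ u ∈ S.steps, q - u ∉ S.lattice := by
  decide +kernel

theorem IsPath.sub_notMem_ballSites (hS : S ∈ systems) (hp : S.IsPath p) {k : ℤ} {y z : Site}
    (hy : y - p (k + 1) ∈ S.lattice) (hz : z - p k ∈ S.lattice) : y - z ∉ ballSites := fun hq => by
  refine (separation S hS _ hq).2.2 _ (hp k) ?_
  convert sub_mem hy hz using 1
  abel

theorem IsPath.abs_index_sub_lt (hS : S ∈ systems) (hp : S.IsPath p) {k l : ℤ} {y z : Site}
    (hy : y - p k ∈ S.lattice) (hz : z - p l ∈ S.lattice) (hq : y - z ∈ ballSites) :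
    |k - l| < 2 := by
  have h := (separation S hS _ hq).1
  rw [dotProduct_sub, hp.dotProduct_of_sub_mem_lattice hy, hp.dotProduct_of_sub_mem_lattice hz,
    add_sub_add_left_eq_sub, ← mul_sub, abs_mul, abs_of_pos S.spacing_pos, mul_comm] at h
  exact lt_of_mul_lt_mul_right h S.spacing_pos.le

theorem IsPath.admissible (hS : S ∈ systems) (hp : S.IsPath p) : Admissible 6 (S.layers p) := by
  rintro y ⟨k, hk⟩ z ⟨l, hl⟩ hne
  by_contra! hlt
  have hq : y - z ∈ ballSites := by rwa [mem_ballSites, sqDist_sub, zero_add, sqDist_comm]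
  have hkl := abs_lt.1 (hp.abs_index_sub_lt hS hk hl hq)
  obtain rfl | rfl | rfl : k = l ∨ k = l + 1 ∨ l = k + 1 := by omega
  · have h := sub_mem hk hl
    rw [sub_sub_sub_cancel_right] at h
    exact hne (sub_eq_zero.1 ((separation S hS _ hq).2.1 h))
  · exact hp.sub_notMem_ballSites hS hk hl hq
  · exact hp.sub_notMem_ballSites hS hl hk (by simpa using neg_mem_ballSites hq)

/-- The site `y` lies in one of the layers through `0`, `u` and `-d`. -/
def InThreeLayers (S : LayerSystem) (u d y : Site) : Prop :=
  y ∈ S.lattice ∨ y - u ∈ S.lattice ∨ y + d ∈ S.lattice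

instance (u d : Site) : DecidablePred (S.InThreeLayers u d) := fun _ =>
  inferInstanceAs (Decidable (_ ∨ _))

theorem covering : ∀ S ∈ systems, ∀ j ∈ List.range S.spacing.toNat,
    ∀ i ∈ List.range S.modulus.toNat, ∀ u ∈ S.steps, ∀ d ∈ S.steps,
      24 ≤ ((ballSites.filter fun q =>
        S.InThreeLayers u d (((j : ℤ) • S.r₀ + (i : ℤ) • S.r₁) + q)).map siteWeight).sum := by
  decide +kernel

theorem IsPath.exists_representative (hp : S.IsPath p) (y : Site) :
    ∃ k, ∃ j ∈ List.range S.spacing.toNat, ∃ i ∈ List.range S.modulus.toNat,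
      y - p k - ((j : ℤ) • S.r₀ + (i : ℤ) • S.r₁) ∈ S.lattice := by
  have hspacing := S.spacing_pos
  have hmodulus := S.modulus_pos
  set t := S.normal ⬝ᵥ y - S.normal ⬝ᵥ p 0
  set k := t / S.spacing
  set t' := S.label ⬝ᵥ (y - p k)
  have hj := Int.emod_nonneg t hspacing.ne'
  have hi := Int.emod_nonneg t' hmodulus.ne'
  have hj' := Int.emod_lt_of_pos t hspacing
  have hi' := Int.emod_lt_of_pos t' hmodulus
  refine ⟨k, (t % S.spacing).toNat, List.mem_range.2 (by omega), (t' % S.modulus).toNat,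
    List.mem_range.2 (by omega), ?_⟩
  rw [Int.toNat_of_nonneg hj, Int.toNat_of_nonneg hi]
  constructor
  · rw [dotProduct_sub, dotProduct_sub, dotProduct_add, dotProduct_smul, dotProduct_smul,
      S.normal_r₀, S.normal_r₁, hp.dotProduct_eq, smul_eq_mul, smul_eq_mul]
    linarith [Int.mul_ediv_add_emod t S.spacing]
  · rw [dotProduct_sub, dotProduct_add, dotProduct_smul, dotProduct_smul, S.label_r₀, S.label_r₁,
      smul_zero, zero_add, smul_eq_mul, mul_one]
    exact Int.dvd_self_sub_emod

theorem InThreeLayers.mem_layers {y : Site} {k : ℤ}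
    (hy : S.InThreeLayers (p (k + 1) - p k) (p k - p (k - 1)) (y - p k)) : y ∈ S.layers p := by
  rcases hy with h | h | h
  · exact ⟨k, h⟩
  · exact ⟨k + 1, by rwa [sub_sub_sub_cancel_right] at h⟩
  · exact ⟨k - 1, by rwa [sub_add_sub_cancel] at h⟩

theorem InThreeLayers.add {u d y z : Site} (hy : S.InThreeLayers u d y) (hz : z ∈ S.lattice) :
    S.InThreeLayers u d (z + y) := by
  unfold InThreeLayers
  rwa [add_sub_assoc, add_assoc, add_mem_cancel_left hz, add_mem_cancel_left hz,
    add_mem_cancel_left hz]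

theorem IsPath.isPerfect (hS : S ∈ systems) (hp : S.IsPath p) : IsPerfect (S.layers p) := by
  refine (hp.admissible hS).isPerfect_of_le_weightIn fun y => ?_
  obtain ⟨k, j, hj, i, hi, hr⟩ := hp.exists_representative y
  have hpred : p k - p (k - 1) ∈ S.steps := by simpa using hp (k - 1)
  refine (covering S hS j hj i hi _ (hp k) _ hpred).trans (sum_filter_le_weightIn fun q hq => ?_)
  have h := hq.add hr
  rw [← add_assoc, sub_add_cancel, sub_add_eq_add_sub] at h
  exact h.mem_layers

end LayerSystem

theorem isPerfect_iff_layers {φ : Set Site} :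
    IsPerfect φ ↔ ∃ S ∈ systems, ∃ p, S.IsPath p ∧ φ = S.layers p := by
  constructor
  · intro hφ
    obtain ⟨S, hS, p, hp, h⟩ := hφ.exists_layers_subset
    exact ⟨S, hS, p, hp, ((hp.isPerfect hS).eq_of_subset hφ.1 h).symm⟩
  · rintro ⟨S, hS, p, hp, rfl⟩
    exact hp.isPerfect hS

/-! ### Layers and stackings of meshes -/

section Shift

variable {G : Type*} [AddCommGroup G]

theorem mem_shift {χ : Set G} {v x : G} : x ∈ shift χ v ↔ x - v ∈ χ := by
  simp [shift, ← sub_eq_add_neg]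

theorem shift_shift (χ : Set G) (v w : G) : shift (shift χ v) w = shift χ (v + w) := by
  ext x
  rw [mem_shift, mem_shift, mem_shift, sub_sub, add_comm]

theorem shift_zero (χ : Set G) : shift χ 0 = χ := by simp [shift]

theorem shift_injective (v : G) : Function.Injective (shift · v : Set G → Set G) :=
  (add_left_injective v).image_injective

theorem shift_eq_shift_iff {H : AddSubgroup G} {x y : G} :
    shift (H : Set G) x = shift H y ↔ x - y ∈ H := by
  constructor
  · intro h
    have hx : x ∈ shift (H : Set G) x := mem_shift.2 (by simp)
    rw [h] at hx
    exact mem_shift.1 hx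
  · intro h
    ext z
    rw [mem_shift, mem_shift, SetLike.mem_coe, SetLike.mem_coe, ← sub_add_sub_cancel z x y,
      add_mem_cancel_right h]

end Shift

/-- A site as a point with rational coordinates. -/
def toPt : Site →+ Pt := (Int.castAddHom ℚ).compLeft (Fin 3)

theorem toPt_injective : Function.Injective toPt := Int.cast_injective.comp_left

theorem toPt_zsmul (n : ℤ) (x : Site) : toPt (n • x) = (n : ℚ) • toPt x := by
  rw [map_zsmul, Int.cast_smul_eq_zsmul]

namespace LayerSystem

variable {S : LayerSystem} {p : ℤ → Site}

/-- The lattice of a layer system as a group of points. -/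
def mesh (S : LayerSystem) : AddSubgroup Pt := S.lattice.map toPt

theorem toPt_mem_mesh {z : Site} : toPt z ∈ S.mesh ↔ z ∈ S.lattice :=
  AddSubgroup.mem_map_iff_mem toPt_injective

theorem coe_mesh (S : LayerSystem) :
    (S.mesh : Set Pt) = planeLattice (toPt S.gen₁) (toPt S.gen₂) := by
  ext x
  constructor
  · rintro ⟨z, hz, rfl⟩
    obtain ⟨a, b, rfl⟩ := S.exists_coeff z hz.1 hz.2
    exact ⟨a, b, by rw [map_add, toPt_zsmul, toPt_zsmul]⟩
  · rintro ⟨a, b, rfl⟩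
    rw [← toPt_zsmul, ← toPt_zsmul, ← map_add]
    exact toPt_mem_mesh.2 (add_mem (zsmul_mem S.gen₁_mem a) (zsmul_mem S.gen₂_mem b))

/-- The displacement along the normal from the layer with index `0` to the layer with index `k`. -/
def height (S : LayerSystem) (k : ℤ) : Pt :=
  ((S.spacing * k : ℚ) / (S.normal ⬝ᵥ S.normal : ℤ)) • toPt S.normal

theorem height_zero (S : LayerSystem) : S.height 0 = 0 := by simp [height]

theorem height_add (S : LayerSystem) (k l : ℤ) : S.height (k + l) = S.height k + S.height l := by
  rw [height, height, height, ← add_smul, ← add_div, ← mul_add, Int.cast_add]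

/-- The projections along the normal of the layers through the points `p k`. -/
def stacking (S : LayerSystem) (p : ℤ → Site) (k : ℤ) : Set Pt :=
  shift S.mesh (toPt (p k) - S.height k)

/-- The vectors by which successive projected layers may differ. -/
def meshSteps (S : LayerSystem) : List Pt := S.steps.map fun u => toPt u - S.height 1

/-- Allowed stackings of the meshes of a layer system. -/
def IsStacking (S : LayerSystem) (γ : ℤ → Set Pt) : Prop :=
  γ 0 = S.mesh ∧ ∀ k, ∃ w ∈ S.meshSteps, γ (k + 1) = shift (γ k) w

/-- The layered configuration of a stacking. -/
def layered (S : LayerSystem) (γ : ℤ → Set Pt) : Set Site :=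
  sitesOf (⋃ k : ℤ, shift (γ k) (S.height k))

theorem stacking_zero (hp : p 0 = 0) : S.stacking p 0 = S.mesh := by
  rw [stacking, hp, map_zero, height_zero, sub_zero, shift_zero]

theorem stacking_add_one (k : ℤ) :
    S.stacking p (k + 1) = shift (S.stacking p k) (toPt (p (k + 1) - p k) - S.height 1) := by
  rw [stacking, stacking, shift_shift, height_add, map_sub, sub_add_sub_comm, add_sub_cancel]

theorem isStacking_iff {γ : ℤ → Set Pt} :
    S.IsStacking γ ↔ ∃ p, p 0 = 0 ∧ S.IsPath p ∧ S.stacking p = γ := by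
  constructor
  · rintro ⟨hγ₀, hγ⟩
    simp only [meshSteps, List.mem_map, exists_exists_and_eq_and] at hγ
    choose u hu hγ using hγ
    obtain ⟨p, hp₀, hp⟩ := exists_int_path (r := fun k (x y : Site) => y - x = u k)
      (fun k x => ⟨x + u k, add_sub_cancel_left _ _⟩) (fun k y => ⟨y - u k, sub_sub_cancel _ _⟩) 0
    refine ⟨p, hp₀, fun k => hp k ▸ hu k, eq_of_int_recursion
      (fun k => shift_injective (toPt (u k) - S.height 1)) ?_ (fun k => ?_) hγ⟩
    · rw [stacking_zero hp₀, hγ₀]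
    · rw [stacking_add_one, hp]
  · rintro ⟨p, hp₀, hp, rfl⟩
    exact ⟨stacking_zero hp₀, fun k => ⟨_, List.mem_map_of_mem (hp k), stacking_add_one k⟩⟩

theorem layered_stacking (S : LayerSystem) (p : ℤ → Site) :
    S.layered (S.stacking p) = S.layers p := by
  ext y
  change toPt y ∈ ⋃ k : ℤ, _ ↔ ∃ k, _
  rw [Set.mem_iUnion]
  refine exists_congr fun k => ?_
  rw [stacking, shift_shift, sub_add_cancel, mem_shift, ← map_sub, SetLike.mem_coe, toPt_mem_mesh]

theorem shift_layers (S : LayerSystem) (p : ℤ → Site) (v : Site) :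
    shift (S.layers p) v = S.layers fun k => p k + v := by
  ext y
  rw [mem_shift]
  exact exists_congr fun k => by rw [sub_sub, add_comm v]

theorem IsPath.add_const (hp : S.IsPath p) (v : Site) : S.IsPath fun k => p k + v := fun k => by
  simpa using hp k

end LayerSystem

theorem triMesh_eq (i : Fin 4) : triMesh i = (triSystem i).mesh := by
  have h : ∀ i, triVec i 1 = toPt (triSystem i).gen₁ ∧ triVec i 2 = toPt (triSystem i).gen₂ := by
    decide +kernel
  rw [triMesh, LayerSystem.coe_mesh, (h i).1, (h i).2]

theorem rhoMesh_eq (i : Fin 6) : rhoMesh i = (rhoSystem i).mesh := by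
  have h : ∀ i, (2 : ℚ) • vecA i + (2 : ℚ) • vecB i = toPt (rhoSystem i).gen₁ ∧
      (2 : ℚ) • vecA i - (2 : ℚ) • vecB i = toPt (rhoSystem i).gen₂ := by
    decide +kernel
  rw [rhoMesh, LayerSystem.coe_mesh, (h i).1, (h i).2]

theorem triSystem_height (i : Fin 4) (k : ℤ) :
    (triSystem i).height k = (4 * (k : ℚ) / 3) • mainDiag i := by
  have h : ∀ i, mainDiag i = toPt (triNormal i) ∧ triNormal i ⬝ᵥ triNormal i = 3 := by
    decide +kernel
  simp only [LayerSystem.height, triSystem, h]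
  norm_num

theorem rhoSystem_height (i : Fin 6) (k : ℤ) :
    (rhoSystem i).height k = (3 * (k : ℚ) / 2) • nonMainDiag i := by
  have h : ∀ i, nonMainDiag i = toPt (rhoNormal i) ∧ rhoNormal i ⬝ᵥ rhoNormal i = 2 := by
    decide +kernel
  simp only [LayerSystem.height, rhoSystem, h]
  norm_num

theorem triSystem_meshSteps (i : Fin 4) : (triSystem i).meshSteps =
    [(1 / 3 : ℚ) • triVec i 2, (1 / 3 : ℚ) • triVec i 4, (1 / 3 : ℚ) • triVec i 6] := by
  revert i
  decide +kernel

theorem rhoSystem_meshSteps (i : Fin 6) :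
    (rhoSystem i).meshSteps = [vecA i + vecB i, vecA i - vecB i] := by
  revert i
  decide +kernel

theorem isTriStacking_iff {i : Fin 4} {γ : ℤ → Set Pt} :
    IsTriStacking i γ ↔ (triSystem i).IsStacking γ := by
  simp [IsTriStacking, LayerSystem.IsStacking, triMesh_eq, triSystem_meshSteps, or_and_right,
    exists_or]

theorem isRhoStacking_iff {i : Fin 6} {γ : ℤ → Set Pt} :
    IsRhoStacking i γ ↔ (rhoSystem i).IsStacking γ := by
  simp [IsRhoStacking, LayerSystem.IsStacking, rhoMesh_eq, rhoSystem_meshSteps]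

theorem triLayered_eq (i : Fin 4) (γ : ℤ → Set Pt) : triLayered i γ = (triSystem i).layered γ := by
  simp only [triLayered, LayerSystem.layered, triSystem_height]

theorem rhoLayered_eq (i : Fin 6) (γ : ℤ → Set Pt) : rhoLayered i γ = (rhoSystem i).layered γ := by
  simp only [rhoLayered, LayerSystem.layered, rhoSystem_height]

theorem exists_isStacking_iff {Q : (ℤ → Set Pt) → Prop} {R : LayerSystem → (ℤ → Site) → Prop}
    (hQR : ∀ S p, S.IsPath p → (Q (S.stacking p) ↔ R S p))
    (hR : ∀ S p v, R S p → R S fun k => p k + v) {φ : Set Site} :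
    (∃ v, (∃ i γ, IsTriStacking i γ ∧ Q γ ∧ φ = shift (triLayered i γ) v) ∨
      ∃ i γ, IsRhoStacking i γ ∧ Q γ ∧ φ = shift (rhoLayered i γ) v) ↔
    ∃ S ∈ systems, ∃ p, S.IsPath p ∧ R S p ∧ φ = S.layers p := by
  have hsystem (S : LayerSystem) :
      (∃ v γ, S.IsStacking γ ∧ Q γ ∧ φ = shift (S.layered γ) v) ↔
        ∃ p, S.IsPath p ∧ R S p ∧ φ = S.layers p := by
    simp only [LayerSystem.isStacking_iff]
    constructor
    · rintro ⟨v, _, ⟨p, -, hp, rfl⟩, hQ, rfl⟩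
      exact ⟨_, hp.add_const v, hR S p v ((hQR S p hp).1 hQ), by
        rw [LayerSystem.layered_stacking, LayerSystem.shift_layers]⟩
    · rintro ⟨p, hp, hRp, rfl⟩
      have hp' := hp.add_const (-p 0)
      refine ⟨p 0, _, ⟨_, add_neg_cancel _, hp', rfl⟩, (hQR S _ hp').2 (hR S p _ hRp), ?_⟩
      simp only [LayerSystem.layered_stacking, LayerSystem.shift_layers, neg_add_cancel_right]
  simp only [isTriStacking_iff, isRhoStacking_iff, triLayered_eq, rhoLayered_eq, exists_or,
    mem_systems, or_and_right, ← hsystem]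
  constructor
  · rintro (⟨v, i, h⟩ | ⟨v, i, h⟩)
    · exact .inl ⟨_, ⟨i, rfl⟩, v, h⟩
    · exact .inr ⟨_, ⟨i, rfl⟩, v, h⟩
  · rintro (⟨_, ⟨i, rfl⟩, v, h⟩ | ⟨_, ⟨i, rfl⟩, v, h⟩)
    · exact .inl ⟨v, i, h⟩
    · exact .inr ⟨v, i, h⟩

theorem mem_layeredSet {φ : Set Site} :
    φ ∈ layeredSet ↔ ∃ S ∈ systems, ∃ p, S.IsPath p ∧ φ = S.layers p := by
  have h := exists_isStacking_iff (Q := fun _ => True) (R := fun _ _ => True) (φ := φ)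
    (fun _ _ _ => Iff.rfl) fun _ _ _ => id
  simp only [true_and] at h
  exact h

/-! ### Periodicity -/

theorem sub_sub_zsmul_mem {G : Type*} [AddCommGroup G] {H : AddSubgroup G} {c : ℤ → G} {n : ℤ}
    {w : G} (h : ∀ k, c (k + n) - c k - w ∈ H) (m k : ℤ) :
    c (k + m * n) - c k - m • w ∈ H := by
  have hstep (m : ℤ) : c (k + (m + 1) * n) - c k - (m + 1) • w ∈ H ↔
      c (k + m * n) - c k - m • w ∈ H := by
    rw [← add_mem_cancel_left (h (k + m * n)) (y := c (k + m * n) - c k - m • w), add_one_mul,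
      add_one_zsmul, ← add_assoc]
    congr! 1
    abel
  induction m using Int.induction_on with
  | zero => simp
  | succ m ih => exact (hstep m).2 ih
  | pred m ih => exact (hstep (-m - 1)).1 (by rwa [sub_add_cancel])

namespace LayerSystem

variable {S : LayerSystem} {p : ℤ → Site}

/-- Paths that are periodic modulo the lattice, up to a translation. -/
def IsPeriodicPath (S : LayerSystem) (p : ℤ → Site) : Prop :=
  ∃ n : ℕ, 0 < n ∧ ∃ v, ∀ k, p (k + n) - p k - v ∈ S.lattice

theorem IsPeriodicPath.add_const (h : S.IsPeriodicPath p) (v : Site) :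
    S.IsPeriodicPath fun k => p k + v := by
  simpa only [IsPeriodicPath, add_sub_add_right_eq_sub] using h

theorem normal_dotProduct_self_pos (S : LayerSystem) : 0 < S.normal ⬝ᵥ S.normal := by
  refine lt_of_le_of_ne (Fintype.sum_nonneg fun _ => mul_self_nonneg _) fun h => ?_
  have h₁ := S.normal_r₀
  rw [dotProduct_self_eq_zero.1 h.symm, zero_dotProduct] at h₁
  exact zero_ne_one h₁

theorem IsPath.dotProduct_translation (hp : S.IsPath p) {n : ℕ} {v : Site}
    (hv : ∀ k, p (k + n) - p k - v ∈ S.lattice) : S.normal ⬝ᵥ v = S.spacing * n := by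
  have h := (hv 0).1
  rw [zero_add, dotProduct_sub, dotProduct_sub, hp.dotProduct_eq] at h
  linarith

theorem modulus_smul_mem_lattice {z : Site} (hz : S.normal ⬝ᵥ z = 0) :
    S.modulus • z ∈ S.lattice := by
  refine ⟨?_, ?_⟩
  · rw [dotProduct_smul, hz, smul_zero]
  · rw [dotProduct_smul]
    exact dvd_mul_right _ _

theorem height_mul_normal (S : LayerSystem) (m : ℤ) :
    S.height (S.normal ⬝ᵥ S.normal * m) = toPt ((S.spacing * m) • S.normal) := by
  have h : ((S.normal ⬝ᵥ S.normal : ℤ) : ℚ) ≠ 0 :=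
    Int.cast_ne_zero.2 S.normal_dotProduct_self_pos.ne'
  rw [toPt_zsmul, height]
  congr 1
  push_cast
  field_simp

theorem stacking_add_eq_iff {k n : ℤ} : S.stacking p (k + n) = S.stacking p k ↔
    toPt (p (k + n) - p k) - S.height n ∈ S.mesh := by
  rw [stacking, stacking, shift_eq_shift_iff, height_add, map_sub]
  congr! 1
  abel

theorem IsPath.isPeriodicStacking_iff (hp : S.IsPath p) :
    IsPeriodicStacking (S.stacking p) ↔ S.IsPeriodicPath p := by
  simp only [IsPeriodicStacking, stacking_add_eq_iff]
  constructor
  · rintro ⟨n, hn, h⟩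
    refine ⟨n, hn, p (0 + n) - p 0, fun k => ?_⟩
    rw [← toPt_mem_mesh, map_sub, ← sub_sub_sub_cancel_right _ _ (S.height n)]
    exact sub_mem (h k) (h 0)
  · rintro ⟨n, hn, v, hv⟩
    set m := S.normal ⬝ᵥ S.normal * S.modulus
    have hm : 0 < m := mul_pos S.normal_dotProduct_self_pos S.modulus_pos
    have hmv : m • v - (S.spacing * (S.modulus * n)) • S.normal ∈ S.lattice := by
      convert modulus_smul_mem_lattice (S := S)
        (z := (S.normal ⬝ᵥ S.normal) • v - (S.spacing * n) • S.normal) ?_ using 1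
      · module
      · simp only [dotProduct_sub, dotProduct_smul, hp.dotProduct_translation hv, smul_eq_mul]
        ring
    refine ⟨m.toNat * n, mul_pos (by omega) hn, fun k => ?_⟩
    rw [Nat.cast_mul, Int.toNat_of_nonneg hm.le, mul_assoc, height_mul_normal, ← map_sub,
      toPt_mem_mesh, ← mul_assoc, ← sub_add_sub_cancel _ (m • v)]
    exact add_mem (sub_sub_zsmul_mem hv m k) hmv

end LayerSystem

theorem mem_periodicLayeredSet {φ : Set Site} : φ ∈ periodicLayeredSet ↔
    ∃ S ∈ systems, ∃ p, S.IsPath p ∧ S.IsPeriodicPath p ∧ φ = S.layers p :=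
  exists_isStacking_iff (fun _ _ hp => hp.isPeriodicStacking_iff) fun _ _ v h => h.add_const v

/-- The translations that preserve a configuration. -/
def translations (φ : Set Site) : AddSubgroup Site where
  carrier := {v | ∀ x, x + v ∈ φ ↔ x ∈ φ}
  zero_mem' := fun x => by rw [add_zero]
  add_mem' := fun {v w} hv hw x => by rw [← add_assoc, hw, hv]
  neg_mem' := fun {v} hv x => by rw [← hv (x + -v), neg_add_cancel_right]

theorem isPeriodic_iff {φ : Set Site} :
    IsPeriodic φ ↔ ∃ N : ℕ, 0 < N ∧ ∀ x, N • x ∈ translations φ := by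
  constructor
  · rintro ⟨e, he, hφ⟩
    set L := Submodule.span ℤ (Set.range e)
    have hfin : Finite (Site ⧸ L.toAddSubgroup) :=
      Submodule.finiteQuotientOfFreeOfRankEq L (by rw [finrank_span_eq_card he]; simp)
    have hL : L ≤ (translations φ).toIntSubmodule :=
      Submodule.span_le.2 (Set.range_subset_iff.2 hφ)
    exact ⟨L.toAddSubgroup.index, Nat.pos_of_ne_zero AddSubgroup.index_ne_zero_of_finite,
      fun x => hL (L.toAddSubgroup.nsmul_index_mem x)⟩
  · rintro ⟨N, hN, h⟩
    refine ⟨fun i => N • Pi.single i 1, ?_, fun i => h _⟩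
    refine Fintype.linearIndependent_iff.2 fun c hc i => ?_
    simpa [Finset.sum_apply, Pi.single_apply, hN.ne'] using congrFun hc i

theorem countable_setOf_isPeriodic : {φ : Set Site | IsPeriodic φ}.Countable := by
  refine Set.Countable.mono (s₂ := ⋃ N : ℕ, Set.range fun A : Set (Fin 3 → ZMod (N + 1)) =>
    {x : Site | (fun l => (x l : ZMod (N + 1))) ∈ A}) (fun φ hφ => ?_)
    (Set.countable_iUnion fun N => Set.countable_range _)
  obtain ⟨N, hN, h⟩ := isPeriodic_iff.1 hφ
  obtain ⟨N, rfl⟩ := Nat.exists_eq_add_of_le' hN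
  refine Set.mem_iUnion.2 ⟨N, (fun x l => (x l : ZMod (N + 1))) '' φ, ?_⟩
  ext x
  refine ⟨?_, fun hx => ⟨x, hx, rfl⟩⟩
  rintro ⟨y, hy, hxy⟩
  have hdvd (l : Fin 3) : ((N + 1 : ℕ) : ℤ) ∣ x l - y l :=
    (ZMod.intCast_eq_intCast_iff_dvd_sub _ _ _).1 (congrFun hxy l)
  choose t ht using hdvd
  have hx : x = y + (N + 1) • t := by
    ext l
    rw [Pi.add_apply, Pi.smul_apply, nsmul_eq_mul, ← ht, add_sub_cancel]
  rw [hx]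
  exact (h t y).2 hy

namespace LayerSystem

variable {S : LayerSystem} {p : ℤ → Site}

theorem self_mem_layers (k : ℤ) : p k ∈ S.layers p := ⟨k, by simp⟩

theorem IsPath.sub_mem_lattice (hp : S.IsPath p) {y : Site} {k : ℤ} (hy : y ∈ S.layers p)
    (h : S.normal ⬝ᵥ y = S.normal ⬝ᵥ p 0 + S.spacing * k) : y - p k ∈ S.lattice := by
  obtain ⟨l, hl⟩ := hy
  have hkl : S.spacing * k = S.spacing * l :=
    add_left_cancel (h.symm.trans (hp.dotProduct_of_sub_mem_lattice hl))
  rwa [mul_left_cancel₀ S.spacing_pos.ne' hkl]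

theorem mem_translations_of_mem_lattice {z : Site} (hz : z ∈ S.lattice) :
    z ∈ translations (S.layers p) := fun x =>
  exists_congr fun k => by rw [add_sub_right_comm, add_mem_cancel_right hz]

theorem mem_translations_of_periodic {n : ℤ} {v : Site}
    (hv : ∀ k, p (k + n) - p k - v ∈ S.lattice) : v ∈ translations (S.layers p) := fun x => by
  refine ((Equiv.addRight n).exists_congr fun k => ?_).symm
  rw [← add_mem_cancel_right (hv k) (y := x + v - _), Equiv.coe_addRight]
  congr! 1
  abel

theorem IsPath.isPeriodic_iff (hp : S.IsPath p) :
    IsPeriodic (S.layers p) ↔ S.IsPeriodicPath p := by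
  rw [_root_.isPeriodic_iff]
  constructor
  · rintro ⟨N, hN, h⟩
    refine ⟨N, hN, N • S.spacing • S.r₀, fun k => ?_⟩
    have hnormal : S.normal ⬝ᵥ (p k + N • S.spacing • S.r₀) =
        S.normal ⬝ᵥ p 0 + S.spacing * (k + N : ℤ) := by
      rw [dotProduct_add, dotProduct_smul, dotProduct_smul, S.normal_r₀, hp.dotProduct_eq,
        nsmul_eq_mul, smul_eq_mul]
      ring
    convert neg_mem (hp.sub_mem_lattice ((h _ (p k)).2 (self_mem_layers k)) hnormal) using 1
    abel
  · rintro ⟨n, hn, v, hv⟩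
    have hpos : 0 < S.modulus * S.spacing * n := by
      have := S.modulus_pos
      have := S.spacing_pos
      positivity
    refine ⟨(S.modulus * S.spacing * n).toNat, by omega, fun x => ?_⟩
    have hx : S.modulus • ((S.spacing * n) • x - (S.normal ⬝ᵥ x) • v) ∈ S.lattice := by
      refine modulus_smul_mem_lattice ?_
      simp only [dotProduct_sub, dotProduct_smul, hp.dotProduct_translation hv, smul_eq_mul]
      ring
    rw [← natCast_zsmul, Int.toNat_of_nonneg hpos.le]
    convert add_mem (mem_translations_of_mem_lattice (p := p) hx)
      (zsmul_mem (mem_translations_of_periodic hv) (S.modulus * (S.normal ⬝ᵥ x))) using 1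
    module

end LayerSystem

theorem isPerfect_and_isPeriodic_iff {φ : Set Site} :
    IsPerfect φ ∧ IsPeriodic φ ↔ φ ∈ periodicLayeredSet := by
  rw [isPerfect_iff_layers, mem_periodicLayeredSet]
  constructor
  · rintro ⟨⟨S, hS, p, hp, rfl⟩, h⟩
    exact ⟨S, hS, p, hp, hp.isPeriodic_iff.1 h, rfl⟩
  · rintro ⟨S, hS, p, hp, h, rfl⟩
    exact ⟨⟨S, hS, p, hp, rfl⟩, hp.isPeriodic_iff.2 h⟩

/-! ### The number of layered configurations -/

/-- Two of the steps of the layer system `triSystem 0`. -/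
def binaryStep (b : Bool) : Site := if b then ![1, 1, 2] else ![1, 2, 1]

theorem binaryStep_mem_steps : ∀ b, binaryStep b ∈ (triSystem 0).steps := by decide

theorem eq_of_binaryStep_sub_mem_lattice :
    ∀ b c, binaryStep b - binaryStep c ∈ (triSystem 0).lattice → b = c := by
  decide

theorem exists_binaryPath (f : ℤ → Bool) :
    ∃ p : ℤ → Site, p 0 = 0 ∧ ∀ k, p (k + 1) = p k + binaryStep (f k) :=
  exists_int_path (r := fun k x y => y = x + binaryStep (f k)) (fun _ _ => ⟨_, rfl⟩)
    (fun _ y => ⟨y - _, (sub_add_cancel y _).symm⟩) 0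

/-- The path whose steps are prescribed by a binary sequence. -/
noncomputable def binaryPath (f : ℤ → Bool) : ℤ → Site := (exists_binaryPath f).choose

theorem binaryPath_zero (f : ℤ → Bool) : binaryPath f 0 = 0 := (exists_binaryPath f).choose_spec.1

theorem binaryPath_add_one (f : ℤ → Bool) (k : ℤ) :
    binaryPath f (k + 1) = binaryPath f k + binaryStep (f k) :=
  (exists_binaryPath f).choose_spec.2 k

theorem isPath_binaryPath (f : ℤ → Bool) : (triSystem 0).IsPath (binaryPath f) := fun k => by
  rw [binaryPath_add_one, add_sub_cancel_left]
  exact binaryStep_mem_steps _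

theorem layers_binaryPath_injective :
    Function.Injective fun f => (triSystem 0).layers (binaryPath f) := by
  intro f g hfg
  have hmem (k : ℤ) : binaryPath f k - binaryPath g k ∈ (triSystem 0).lattice := by
    have hlayers : (triSystem 0).layers (binaryPath f) = (triSystem 0).layers (binaryPath g) := hfg
    have hk : binaryPath f k ∈ (triSystem 0).layers (binaryPath g) :=
      hlayers ▸ LayerSystem.self_mem_layers k
    refine (isPath_binaryPath g).sub_mem_lattice hk ?_
    rw [(isPath_binaryPath f).dotProduct_eq, binaryPath_zero, binaryPath_zero]
  funext k
  have h := sub_mem (hmem (k + 1)) (hmem k)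
  rw [binaryPath_add_one, binaryPath_add_one, add_sub_add_comm, add_sub_cancel_left] at h
  exact eq_of_binaryStep_sub_mem_lattice _ _ h

theorem isPeriodicPath_binaryPath {f : ℤ → Bool} {n : ℕ} (hn : 0 < n) (hf : ∀ k, f (k + n) = f k) :
    (triSystem 0).IsPeriodicPath (binaryPath f) := by
  have hadd : (fun k => binaryPath f (k + n)) = fun k => binaryPath f k + binaryPath f n := by
    refine eq_of_int_recursion (fun k => add_left_injective (binaryStep (f k))) ?_ ?_ ?_
    · simp [binaryPath_zero]
    · intro k
      simp only [add_right_comm k 1, binaryPath_add_one, hf]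
    · intro k
      simp only [binaryPath_add_one, add_right_comm]
  refine ⟨n, hn, binaryPath f n, fun k => ?_⟩
  rw [congrFun hadd k, add_sub_cancel_left, sub_self]
  exact zero_mem _

theorem mk_layeredSet : Cardinal.mk layeredSet = Cardinal.continuum := by
  apply le_antisymm
  · calc Cardinal.mk layeredSet ≤ Cardinal.mk (Set Site) := Cardinal.mk_set_le _
      _ = Cardinal.continuum := by
        rw [Cardinal.mk_set, Cardinal.mk_eq_aleph0, Cardinal.two_power_aleph0]
  · calc Cardinal.continuum = Cardinal.mk (ℤ → Bool) := by simp
      _ = Cardinal.mk (Set.range fun f => (triSystem 0).layers (binaryPath f)) :=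
        (Cardinal.mk_range_eq _ layers_binaryPath_injective).symm
      _ ≤ Cardinal.mk layeredSet := by
        refine Cardinal.mk_le_mk_of_subset (Set.range_subset_iff.2 fun f => ?_)
        exact mem_layeredSet.2 ⟨_, triSystem_mem_systems 0, _, isPath_binaryPath f, rfl⟩

theorem infinite_periodicLayeredSet : periodicLayeredSet.Infinite := by
  refine Set.infinite_of_injective_forall_mem (f := fun n : ℕ =>
    (triSystem 0).layers (binaryPath fun k => decide (((n + 1 : ℕ) : ℤ) ∣ k))) ?_ fun n => ?_
  · intro m n h
    have hdvd (k : ℕ) : m + 1 ∣ k ↔ n + 1 ∣ k := by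
      have hk := congrFun (layers_binaryPath_injective h) k
      simpa only [decide_eq_decide, Int.natCast_dvd_natCast] using hk
    exact Nat.succ_injective (Nat.dvd_antisymm ((hdvd _).2 dvd_rfl) ((hdvd _).1 dvd_rfl))
  · exact mem_periodicLayeredSet.2 ⟨_, triSystem_mem_systems 0, _, isPath_binaryPath _,
      isPeriodicPath_binaryPath n.succ_pos (by simp), rfl⟩

theorem mk_periodicLayeredSet : Cardinal.mk periodicLayeredSet = Cardinal.aleph0 := by
  have hcount : periodicLayeredSet.Countable := countable_setOf_isPeriodic.mono fun φ hφ =>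
    (isPerfect_and_isPeriodic_iff.2 hφ).2
  have := hcount.to_subtype
  have := infinite_periodicLayeredSet.to_subtype
  exact Cardinal.mk_eq_aleph0 _

/-! ### Density -/

/-- The sites of the cube `[-n, n]³`, as a finite set. -/
noncomputable def cube (n : ℕ) : Finset Site := Finset.Icc (fun _ => -(n : ℤ)) fun _ => (n : ℤ)

open Classical in
/-- The occupied sites of the cube `[-n, n]³`. -/
noncomputable def occupied (φ : Set Site) (n : ℕ) : Finset Site := {x ∈ cube n | x ∈ φ}

theorem card_cube (n : ℕ) : (cube n).card = (2 * n + 1) ^ 3 := by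
  rw [cube, Pi.card_Icc, Fin.prod_const, Int.card_Icc]
  congr 1
  omega

theorem mem_cube_of_mem_ball {n : ℕ} {x y : Site} (hx : x ∈ cube n) (hy : y ∈ ball x) :
    y ∈ cube (n + 2) := by
  have hyx := Finset.mem_Icc.1 (Finset.mem_filter.1 hy).1
  have hx := Finset.mem_Icc.1 hx
  refine Finset.mem_Icc.2 ⟨fun l => ?_, fun l => ?_⟩
  · have hxl : -(n : ℤ) ≤ x l := hx.1 l
    have hyl : x l - 2 ≤ y l := hyx.1 l
    push_cast
    linarith
  · have hxl : x l ≤ n := hx.2 l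
    have hyl : y l ≤ x l + 2 := hyx.2 l
    push_cast
    linarith

theorem cube_subset_cube {m n : ℕ} (h : m ≤ n) : cube m ⊆ cube n :=
  Finset.Icc_subset_Icc (fun _ => by simpa using h) fun _ => by simpa using h

theorem mem_ball_comm {x y : Site} : y ∈ ball x ↔ x ∈ ball y := by
  rw [mem_ball, mem_ball, sqDist_comm]

theorem force_nonneg (t : ℤ) : 0 ≤ force t := by
  rw [force_eq_forceWeight]
  positivity

theorem sum_force_ball (y : Site) : ∑ x ∈ ball y, force (sqDist x y) = 12 := by
  have hsum : ∑ p ∈ ballSites.toFinset, siteWeight p = 288 := by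
    rw [List.sum_toFinset _ nodup_ballSites]
    decide +kernel
  have hforce (p : Site) : force (sqDist (y + p) y) = (siteWeight p : ℚ) / 24 := by
    rw [sqDist_comm, sqDist_self_add, force_eq_forceWeight, siteWeight]
  rw [ball_eq_image, Finset.sum_image (add_right_injective y).injOn]
  simp only [hforce]
  rw [← Finset.sum_div, ← Nat.cast_sum, hsum]
  norm_num

theorem sum_cube_potential (φ : Set Site) (n : ℕ) :
    ∑ x ∈ cube n, potential φ x =
      1 / 12 * ∑ y ∈ occupied φ (n + 2), ∑ x ∈ cube n with x ∈ ball y, force (sqDist x y) := by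
  classical
  simp only [potential, ← Finset.mul_sum, ← Finset.sum_filter]
  congr 1
  refine Finset.sum_comm' fun x y => ?_
  simp only [occupied, Finset.mem_filter]
  constructor
  · exact fun ⟨hx, hy, hyφ⟩ => ⟨⟨hx, mem_ball_comm.1 hy⟩, mem_cube_of_mem_ball hx hy, hyφ⟩
  · exact fun ⟨⟨hx, hxy⟩, _, hyφ⟩ => ⟨hx, mem_ball_comm.2 hxy, hyφ⟩

theorem sum_cube_potential_le (φ : Set Site) (n : ℕ) :
    ∑ x ∈ cube n, potential φ x ≤ (occupied φ (n + 2)).card := by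
  have hforce : ∀ y ∈ occupied φ (n + 2),
      ∑ x ∈ cube n with x ∈ ball y, force (sqDist x y) ≤ 12 := fun y _ => by
    rw [← sum_force_ball y]
    exact Finset.sum_le_sum_of_subset_of_nonneg (fun x hx => (Finset.mem_filter.1 hx).2)
      fun _ _ _ => force_nonneg _
  have hsum := Finset.sum_le_card_nsmul _ _ _ hforce
  rw [nsmul_eq_mul] at hsum
  rw [sum_cube_potential]
  linarith

theorem card_occupied_le_sum_cube_potential (φ : Set Site) (n : ℕ) :
    (occupied φ n).card ≤ ∑ x ∈ cube (n + 2), potential φ x := by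
  classical
  have hforce : ∀ y ∈ occupied φ n,
      12 ≤ ∑ x ∈ cube (n + 2) with x ∈ ball y, force (sqDist x y) := fun y hy => by
    rw [← sum_force_ball y]
    refine Finset.sum_le_sum_of_subset_of_nonneg (fun x hx => ?_) fun _ _ _ => force_nonneg _
    exact Finset.mem_filter.2 ⟨mem_cube_of_mem_ball (Finset.mem_filter.1 hy).1 hx, hx⟩
  have hsubset : occupied φ n ⊆ occupied φ (n + 2 + 2) := 
    Finset.filter_subset_filter _ (cube_subset_cube (by omega))
  have hnonneg (y : Site) :
      0 ≤ ∑ x ∈ cube (n + 2) with x ∈ ball y, force (sqDist x y) :=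
    Finset.sum_nonneg fun _ _ => force_nonneg _
  have hmono := Finset.sum_le_sum_of_subset_of_nonneg hsubset fun y _ _ => hnonneg y
  have hsum := (Finset.card_nsmul_le_sum _ _ _ hforce).trans hmono
  rw [nsmul_eq_mul] at hsum
  rw [sum_cube_potential]
  linarith

theorem IsPerfect.sum_cube_potential {φ : Set Site} (hφ : IsPerfect φ) (n : ℕ) :
    ∑ x ∈ cube n, potential φ x = 1 / 12 * (2 * n + 1) ^ 3 := by
  rw [Finset.sum_congr rfl fun x _ => (isPerfect_iff_potential.1 hφ).2 x, Finset.sum_const,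
    card_cube, nsmul_eq_mul]
  push_cast
  ring

theorem IsPerfect.card_cube_le {φ : Set Site} (hφ : IsPerfect φ) (n : ℕ) :
    (2 * n + 1) ^ 3 ≤ 12 * (occupied φ (n + 2)).card := by
  have h := hφ.sum_cube_potential n ▸ sum_cube_potential_le φ n
  have : (2 * n + 1 : ℚ) ^ 3 ≤ 12 * (occupied φ (n + 2)).card := by linarith
  exact_mod_cast this

theorem IsPerfect.card_occupied_le {φ : Set Site} (hφ : IsPerfect φ) (n : ℕ) :
    12 * (occupied φ n).card ≤ (2 * (n + 2) + 1) ^ 3 := by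
  have h := hφ.sum_cube_potential (n + 2) ▸ card_occupied_le_sum_cube_potential φ n
  push_cast at h
  have : 12 * ((occupied φ n).card : ℚ) ≤ (2 * (n + 2) + 1) ^ 3 := by linarith
  exact_mod_cast this

theorem tendsto_cube_ratio (c : ℝ) :
    Filter.Tendsto (fun n : ℕ => 1 / 12 * (2 * (n : ℝ) + c) ^ 3 / (2 * (n : ℝ) + 1) ^ 3)
      Filter.atTop (nhds (1 / 12)) := by
  have htop : Filter.Tendsto (fun n : ℕ => 2 * (n : ℝ) + 1) Filter.atTop Filter.atTop :=
    Filter.tendsto_atTop_add_const_right _ _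
      (tendsto_natCast_atTop_atTop.const_mul_atTop two_pos)
  have h := (((htop.const_div_atTop (c - 1)).const_add 1).pow 3).const_mul (1 / 12)
  rw [add_zero, one_pow, mul_one] at h
  refine h.congr fun n => ?_
  have hne : 2 * (n : ℝ) + 1 ≠ 0 := by positivity
  field_simp
  ring

theorem IsPerfect.hasDensity {φ : Set Site} (hφ : IsPerfect φ) : HasDensity φ (1 / 12) := by
  have hcard (n : ℕ) : (φ ∩ Set.Icc (fun _ => -(n : ℤ)) fun _ => (n : ℤ)).ncard =
      (occupied φ n).card := by
    rw [← Set.ncard_coe_finset, occupied, cube, Finset.coe_filter]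
    congr 1
    ext x
    rw [Set.mem_inter_iff, Set.mem_ofPred_eq, Finset.mem_Icc, Set.mem_Icc, and_comm]
  simp only [HasDensity, hcard]
  refine tendsto_of_tendsto_of_tendsto_of_le_of_le' (tendsto_cube_ratio (-3))
    (tendsto_cube_ratio 5) ?_ (.of_forall fun n => ?_)
  · filter_upwards [Filter.eventually_ge_atTop 2] with n hn
    obtain ⟨m, rfl⟩ := Nat.exists_eq_add_of_le' hn
    have h : (2 * m + 1 : ℝ) ^ 3 ≤ 12 * (occupied φ (m + 2)).card := by
      exact_mod_cast hφ.card_cube_le m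
    have hm : 2 * ((m + 2 : ℕ) : ℝ) + -3 = 2 * m + 1 := by
      push_cast
      ring
    rw [hm]
    gcongr
    linarith
  · have h : 12 * ((occupied φ n).card : ℝ) ≤ (2 * (n + 2) + 1) ^ 3 := by
      exact_mod_cast hφ.card_occupied_le n
    have hn : 2 * (n : ℝ) + 5 = 2 * (n + 2) + 1 := by ring
    rw [hn]
    gcongr
    linarith

theorem mainTheorem9 :
    {φ : Set Site | IsPerfect φ} = layeredSet ∧
    Cardinal.mk layeredSet = Cardinal.continuum ∧
    {φ : Set Site | IsPerfect φ ∧ IsPeriodic φ} = periodicLayeredSet ∧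
    Cardinal.mk periodicLayeredSet = Cardinal.aleph0 ∧
    ∀ φ ∈ layeredSet, HasDensity φ (1 / 12) := by
  have h (φ : Set Site) : IsPerfect φ ↔ φ ∈ layeredSet :=
    isPerfect_iff_layers.trans mem_layeredSet.symm
  exact ⟨Set.ext h, mk_layeredSet, Set.ext fun _ => isPerfect_and_isPeriodic_iff,
    mk_periodicLayeredSet, fun φ hφ => ((h φ).2 hφ).hasDensity⟩
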